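/- Fix an integer $m\ge 1$. For each integer $n\ge 1$, coupons are drawn one at a time, independently and uniformly from $n$ types. Let $T=T(n)$ be the number of coupons drawn until every type has been seen at least $m$ times, and let $S_k=S_k(n)$ be the number of types seen exactly $k$ times by time $T$. For $n\ge 2$ put $$c_m(n)=e\log n+\Bigl((e-1)(m-1)-\tfrac12\Bigr)\log\log n .$$ 1) Let $d\in\mathbb{R}$, let $(n_j)_j$ be a strictly increasing sequence of positive integers, and let $(d_j)_j$ be a sequence of real numbers with $d_j\to d$ such that $k_j=c_m(n_j)+d_j$ is a non-negative integer for every $j$ with $n_j\ge 2$. Then, as $j\to\infty$, the pair $$\left(\frac{T-n_j\log n_j-(m-1)n_j\log\log n_j}{n_j},\;S_{k_j}\right)\qquad(\text{with } n=n_j)$$ converges in distribution to a pair $(X,Y)$, where $X$ has the Gumbel distribution function $P(X\le x)=\exp\bigl(-e^{-x}/(m-1)!\bigr)$, i.e. $X\sim\mathrm{Gumbel}(-\log((m-1)!),1)$, and, conditionally on $X$, $Y$ is Poisson distributed with mean $e^{(e-1)X-d}/\sqrt{2\pi e}$. 2) Let $g$ be a real-valued function on the positive integers with $g(n)\to\infty$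 and $g(n)=o(\log\log n)$ such that $k=k(n)=c_m(n)+g(n)$ is a non-negative integer for every $n\ge 2$. Then $S_{k(n)}\to 0$ in probability as $n\to\infty$, i.e. $P(|S_{k(n)}|\ge\varepsilon)\to 0$ for every $\varepsilon>0$. 3) Let $g$ be a real-valued function on the positive integers with $g(n)\to\infty$ and $g(n)=o(\log\log n)$ such that $k=k(n)=c_m(n)-g(n)$ is a non-negative integer for every $n\ge 2$. Then $P(S_{k(n)}=0)\to 0$ as $n\to\infty$. -/

import Mathlib

open Filter MeasureTheory ProbabilityTheory
open scoped NNReal ENNReal Topology Nat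

namespace CouponCollector

/-- The number of copies of coupon `i` among the first `t` coupons of the sequence `c`. -/
def copies {n : ℕ} (c : ℕ → Fin n) (t : ℕ) (i : Fin n) : ℕ :=
  ((Finset.range t).filter (fun s => c s = i)).card

/-- `T`: the least number of coupons after which each of the `n` types has been seen at least `m`
times. (On the null event that this never happens, the value is `0`.) -/
noncomputable def total {n : ℕ} (m : ℕ) (c : ℕ → Fin n) : ℕ :=
  sInf {t : ℕ | ∀ i : Fin n, m ≤ copies c t i}

/-- `S_k`: the number of `k`-tons, i.e. of types that have been seen exactly `k` times by the
time `T`. -/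
noncomputable def kTons {n : ℕ} (m k : ℕ) (c : ℕ → Fin n) : ℕ :=
  (Finset.univ.filter (fun i : Fin n => copies c (total m c) i = k)).card

/-- The coupon model: `C 0, C 1, …` are independent and uniformly distributed on the `n` types. -/
structure IsCouponSequence {Ω : Type*} [MeasurableSpace Ω] {n : ℕ} (C : ℕ → Ω → Fin n)
    (P : Measure Ω) : Prop where
  measurable : ∀ t, Measurable (C t)
  indep : iIndepFun C P
  uniform : ∀ (t : ℕ) (i : Fin n), P {ω | C t ω = i} = (n : ℝ≥0∞)⁻¹

/-- The normalized total `(T - n log n - (m - 1) n log log n) / n`. -/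
noncomputable def normalizedTotal {n : ℕ} (m : ℕ) (c : ℕ → Fin n) : ℝ :=
  ((total m c : ℝ) - n * Real.log n - ((m : ℝ) - 1) * n * Real.log (Real.log n)) / n

/-- The cumulative distribution function `x ↦ exp (-exp (-(x - μ) / β))` of the Gumbel
distribution. -/
noncomputable def gumbelCDF (μ β : ℝ) (hβ : 0 < β) : StieltjesFunction ℝ where
  toFun x := Real.exp (-Real.exp (-(x - μ) / β))
  mono' := by
    intro x y hxy
    have h : -(y - μ) / β ≤ -(x - μ) / β := by gcongr
    exact Real.exp_le_exp.2 (neg_le_neg (Real.exp_le_exp.2 h))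
  right_continuous' x := by
    apply Continuous.continuousWithinAt
    fun_prop

/-- The Gumbel distribution with location `μ` and scale `β`. -/
noncomputable def gumbel (μ β : ℝ) (hβ : 0 < β) : Measure ℝ := (gumbelCDF μ β hβ).measure

instance isProbabilityMeasure_gumbel (μ β : ℝ) (hβ : 0 < β) :
    IsProbabilityMeasure (gumbel μ β hβ) := by
  apply StieltjesFunction.isProbabilityMeasure
  · refine Real.tendsto_exp_atBot.comp (tendsto_neg_atTop_atBot.comp
      (Real.tendsto_exp_atTop.comp (Tendsto.atTop_div_const hβ
        (tendsto_neg_atBot_atTop.comp (tendsto_atBot_add_const_right _ (-μ) tendsto_id)))))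
  · have h : Tendsto (fun x : ℝ => -(x - μ) / β) atTop atBot :=
      Tendsto.atBot_div_const hβ
        (tendsto_neg_atTop_atBot.comp (tendsto_atTop_add_const_right _ (-μ) tendsto_id))
    have h2 := ((Real.continuous_exp.tendsto _).comp (Real.tendsto_exp_atBot.comp h).neg)
    rw [neg_zero, Real.exp_zero] at h2
    exact h2

/-- The Poisson parameter `exp ((e - 1) x - d) / √(2 π e)`; it is positive, so that `toNNReal`
does not change its value. -/
noncomputable def rate (d x : ℝ) : ℝ≥0 :=
  (Real.exp ((Real.exp 1 - 1) * x - d) / √(2 * Real.pi * Real.exp 1)).toNNReal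

theorem measurable_poisson_rate (d : ℝ) : Measurable fun x : ℝ => poissonMeasure (rate d x) := by
  refine Measure.measurable_of_measurable_coe _ fun s _ => ?_
  have hr : Measurable fun x : ℝ => (rate d x : ℝ) := by
    unfold rate
    fun_prop
  simp only [poissonMeasure, Measure.sum_apply _ (MeasurableSet.of_discrete (s := s)),
    Measure.smul_apply, smul_eq_mul]
  fun_prop

/-- The kernel `x ↦ Pois (exp ((e - 1) x - d) / √(2 π e))`. -/
noncomputable def poissonKernel (d : ℝ) : Kernel ℝ ℕ where
  toFun x := poissonMeasure (rate d x)
  measurable' := measurable_poisson_rate d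

instance isMarkovKernel_poissonKernel (d : ℝ) : IsMarkovKernel (poissonKernel d) :=
  ⟨fun x => inferInstanceAs (IsProbabilityMeasure (poissonMeasure (rate d x)))⟩

/-- The law of a pair `(X, Y)` with `X ∼ Gumbel (-log (m - 1)!, 1)` and, conditionally on `X`,
`Y ∼ Pois (exp ((e - 1) X - d) / √(2 π e))`. -/
noncomputable def limitLaw (m : ℕ) (d : ℝ) : Measure (ℝ × ℕ) :=
  (gumbel (-Real.log ((m - 1)! : ℕ)) 1 one_pos) ⊗ₘ (poissonKernel d)

instance isProbabilityMeasure_limitLaw (m : ℕ) (d : ℝ) : IsProbabilityMeasure (limitLaw m d) := by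
  unfold limitLaw
  infer_instance

/-- The centring `e log n + ((e - 1)(m - 1) - 1/2) log log n`. -/
noncomputable def centre (m n : ℕ) : ℝ :=
  Real.exp 1 * Real.log n
    + ((Real.exp 1 - 1) * ((m : ℝ) - 1) - 1 / 2) * Real.log (Real.log n)

end CouponCollector

open CouponCollector

/-!
The event `T = s + 1` means that after `s` coupons exactly one type has fewer than `m` copies, that
it has `m - 1`, and that the next coupon, independent of the first `s`, is of that type, which has
probability `1 / n`. So the joint law of `T` and `S_k` is a statement about the vector of counts at
the fixed time `s`. Its mixed factorial moments are asymptotically those of independent Poisson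
counts of mean `s / n`, and alternating truncated sums of them (Bonferroni) bound
`n * P(T = s + 1, S_k = j)` from below, in the limit, by the Gumbel density times the Poisson weight
at `j` whenever `(s - n log n - (m - 1) n log log n) / n` converges.

Lower bounds suffice. By Fatou's lemma they integrate to
`liminf P((T', S_k) ∈ G) ≥ P((X, Y) ∈ G)` for every open `G`, where `T'` is the normalized `T`,
which is convergence in distribution. When the mean of `S_k` tends to `0` or to `∞`, they integrate
to `liminf P(S_k = 0) ≥ 1`, respectively `liminf P(S_k ≠ 0) ≥ 1`, because the Gumbel density has
total mass `1`.
-/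

namespace CouponCollector

section Counts

variable {Ω : Type*} {n : ℕ} {C : ℕ → Ω → Fin n}

/-- The vector of the numbers of copies of all the types among the first `t` coupons. -/
def counts (C : ℕ → Ω → Fin n) (t : ℕ) (ω : Ω) (i : Fin n) : ℕ :=
  copies (fun s => C s ω) t i

lemma copies_zero (c : ℕ → Fin n) (i : Fin n) : copies c 0 i = 0 := by simp [copies]

lemma copies_succ (c : ℕ → Fin n) (t : ℕ) (i : Fin n) :
    copies c (t + 1) i = copies c t i + if c t = i then 1 else 0 := by
  rw [copies, copies, Finset.range_add_one, Finset.filter_insert]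
  split_ifs <;> simp

lemma copies_mono (c : ℕ → Fin n) (i : Fin n) : Monotone fun t => copies c t i :=
  monotone_nat_of_le_succ fun t => by simp [copies_succ]

lemma copies_eq_sum (c : ℕ → Fin n) (t : ℕ) (i : Fin n) :
    copies c t i = ∑ s : Finset.range t, if c s = i then 1 else 0 := by
  rw [copies, Finset.card_filter, ← Finset.sum_coe_sort]

lemma counts_succ (t : ℕ) (ω : Ω) (i : Fin n) :
    counts C (t + 1) ω i = counts C t ω i + if C t ω = i then 1 else 0 :=
  copies_succ _ _ _

variable [MeasurableSpace Ω] {P : Measure Ω}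

lemma IsCouponSequence.measurable_counts (hC : IsCouponSequence C P) (t : ℕ) :
    Measurable (counts C t) := by
  refine measurable_pi_lambda _ fun i => ?_
  induction t with
  | zero => simp [counts, copies_zero]
  | succ t ih =>
    simp only [counts_succ]
    exact ih.add (Measurable.ite (hC.measurable t (measurableSet_singleton i))
      measurable_const measurable_const)

lemma IsCouponSequence.measurableSet_counts (hC : IsCouponSequence C P) (t : ℕ)
    (A : Set (Fin n → ℕ)) : MeasurableSet {ω | counts C t ω ∈ A} :=
  hC.measurable_counts t (MeasurableSet.of_discrete (s := A))

lemma IsCouponSequence.indepFun_counts (hC : IsCouponSequence C P) (t : ℕ) :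
    IndepFun (counts C t) (C t) P := by
  have hpast := hC.indep.indepFun_finset (Finset.range t) {t} (by simp) hC.measurable
  let countsOfPast : (Finset.range t → Fin n) → Fin n → ℕ :=
    fun c i => ∑ s : Finset.range t, if c s = i then 1 else 0
  have hcounts : countsOfPast ∘ (fun ω (s : Finset.range t) => C s ω) = counts C t := by
    ext ω i
    simp [countsOfPast, counts, copies_eq_sum]
  rw [← hcounts]
  exact hpast.comp (Measurable.of_discrete (f := countsOfPast))
    (measurable_pi_apply (⟨t, by simp⟩ : ({t} : Finset ℕ)))

lemma IsCouponSequence.measureReal_counts_inter (hC : IsCouponSequence C P) (t : ℕ)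
    (A : Set (Fin n → ℕ)) (i : Fin n) :
    P.real {ω | counts C t ω ∈ A ∧ C t ω = i} = P.real {ω | counts C t ω ∈ A} / n := by
  have hindep : P {ω | counts C t ω ∈ A ∧ C t ω = i} =
      P {ω | counts C t ω ∈ A} * P {ω | C t ω = i} :=
    (hC.indepFun_counts t).measure_inter_preimage_eq_mul A {i} MeasurableSet.of_discrete
      (measurableSet_singleton i)
  rw [measureReal_def, hindep, hC.uniform, ENNReal.toReal_mul, ENNReal.toReal_inv,
    ENNReal.toReal_natCast, measureReal_def, div_eq_mul_inv]

lemma IsCouponSequence.isProbabilityMeasure (hC : IsCouponSequence C P) :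
    IsProbabilityMeasure P :=
  hC.indep.isProbabilityMeasure

lemma IsCouponSequence.pos (hC : IsCouponSequence C P) : 0 < n :=
  have := hC.isProbabilityMeasure
  (C 0 (nonempty_of_isProbabilityMeasure P).some).pos

end Counts

section ExactLaw

/-- The probability that `r` given types, of which `s` copies in total are prescribed, have the
prescribed numbers of copies among the first `t` coupons, up to the product of the inverse
factorials of these numbers. -/
noncomputable def countWeight (n t r s : ℕ) : ℝ :=
  t.descFactorial s * ((n : ℝ)⁻¹) ^ s * (1 - r / n) ^ (t - s)

lemma countWeight_succ_succ (n t r s : ℕ) :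
    countWeight n (t + 1) r (s + 1) =
      (1 - r / n) * countWeight n t r (s + 1) + (n : ℝ)⁻¹ * (s + 1) * countWeight n t r s := by
  unfold countWeight
  rcases lt_trichotomy s t with h | rfl | h
  · obtain ⟨u, rfl⟩ := Nat.exists_eq_add_of_lt h
    rw [Nat.succ_descFactorial_succ, Nat.descFactorial_succ,
      show s + u + 1 + 1 - (s + 1) = u + 1 by lia, show s + u + 1 - (s + 1) = u by lia,
      show s + u + 1 - s = u + 1 by lia]
    push_cast
    ring
  · rw [Nat.succ_descFactorial_succ, Nat.descFactorial_of_lt (Nat.lt_succ_self s)]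
    simp only [Nat.cast_mul, Nat.cast_add, Nat.cast_one, inv_pow, tsub_self, pow_zero, mul_one,
      CharP.cast_eq_zero, zero_mul, le_add_iff_nonneg_right, zero_le, Nat.sub_eq_zero_of_le,
      mul_zero, zero_add]
    ring
  · rw [Nat.descFactorial_of_lt h, Nat.descFactorial_of_lt (Nat.lt_succ_of_lt h),
      Nat.descFactorial_of_lt (Nat.succ_lt_succ h)]
    simp

lemma countWeight_succ_zero (n t r : ℕ) :
    countWeight n (t + 1) r 0 = (1 - r / n) * countWeight n t r 0 := by
  simp [countWeight, pow_succ, mul_comm]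

variable {Ω : Type*} [MeasurableSpace Ω] {P : Measure Ω} {n : ℕ} {C : ℕ → Ω → Fin n}
  {ι : Type*} [Fintype ι]

lemma IsCouponSequence.measureReal_counts_succ (hC : IsCouponSequence C P) (t : ℕ)
    (A : Set (Fin n → ℕ)) :
    P.real {ω | counts C (t + 1) ω ∈ A} =
      ∑ i, (n : ℝ)⁻¹ * P.real {ω | counts C t ω + Pi.single i 1 ∈ A} := by
  have := hC.isProbabilityMeasure
  have hsucc (ω : Ω) : counts C (t + 1) ω = counts C t ω + Pi.single (C t ω) 1 := by
    ext i
    simp [counts_succ, Pi.single_apply, eq_comm]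
  have hindep (i : Fin n) : (n : ℝ)⁻¹ * P.real {ω | counts C t ω + Pi.single i 1 ∈ A} =
      P.real {ω | counts C t ω + Pi.single i 1 ∈ A ∧ C t ω = i} := by
    rw [← div_eq_inv_mul]
    exact (hC.measureReal_counts_inter t {N | N + Pi.single i 1 ∈ A} i).symm
  simp only [hindep]
  rw [← measureReal_biUnion_finset]
  · congr 1
    ext ω
    simp [hsucc]
  · exact fun i _ j _ hij => Set.disjoint_left.2 fun ω h₁ h₂ => hij (h₁.2.symm.trans h₂.2)
  · intro i _
    exact (hC.measurableSet_counts t {N | N + Pi.single i 1 ∈ A}).inter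
      (hC.measurable t (measurableSet_singleton i))

lemma IsCouponSequence.measureReal_counts_succ_comp [DecidableEq ι] (hC : IsCouponSequence C P)
    (t : ℕ) (f : ι ↪ Fin n) (b : ι → ℕ) :
    P.real {ω | counts C (t + 1) ω ∘ f = b} =
      (1 - Fintype.card ι / n) * P.real {ω | counts C t ω ∘ f = b} +
        ∑ a, (n : ℝ)⁻¹ * P.real {ω | counts C t ω ∘ f + Pi.single a 1 = b} := by
  have hn : (n : ℝ) ≠ 0 := by exact_mod_cast hC.pos.ne'
  have hout (i : Fin n) (hi : i ∈ (Finset.univ.map f)ᶜ) :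
      P.real {ω | (counts C t ω + Pi.single i 1) ∘ f = b} = P.real {ω | counts C t ω ∘ f = b} := by
    have hne (a : ι) : f a ≠ i := fun h =>
      Finset.mem_compl.1 hi (h ▸ Finset.mem_map_of_mem f (Finset.mem_univ a))
    simp [funext_iff, hne]
  have hin (a : ι) (N : Fin n → ℕ) : (N + Pi.single (f a) 1) ∘ f = N ∘ f + Pi.single a 1 := by
    ext a'
    simp [Pi.single_apply]
  have hsucc := hC.measureReal_counts_succ t {N | N ∘ f = b}
  simp only [Set.mem_ofPred_eq] at hsucc
  rw [hsucc, ← Finset.sum_compl_add_sum (Finset.univ.map f), Finset.sum_map]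
  simp only [hin]
  rw [Finset.sum_congr rfl fun i hi => by rw [hout i hi], Finset.sum_const,
    Finset.card_compl, Finset.card_map, Fintype.card_fin, Finset.card_univ, nsmul_eq_mul,
    Nat.cast_sub (by simpa using Fintype.card_le_of_embedding f)]
  congr 1
  field_simp

lemma prod_inv_factorial_add_single [DecidableEq ι] (b : ι → ℕ) (a : ι) :
    (b a + 1) * ∏ x, (((b + Pi.single a 1 : ι → ℕ) x)! : ℝ)⁻¹ = ∏ x, ((b x)! : ℝ)⁻¹ := by
  rw [← Finset.mul_prod_erase _ _ (Finset.mem_univ a),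
    ← Finset.mul_prod_erase _ _ (Finset.mem_univ a), ← mul_assoc]
  congr 1
  · rw [Pi.add_apply, Pi.single_eq_same, Nat.factorial_succ]
    push_cast
    field_simp
  · refine Finset.prod_congr rfl fun x hx => ?_
    rw [Pi.add_apply, Pi.single_eq_of_ne (Finset.ne_of_mem_erase hx), add_zero]

theorem IsCouponSequence.measureReal_counts_comp_eq (hC : IsCouponSequence C P) (t : ℕ)
    (f : ι ↪ Fin n) (b : ι → ℕ) :
    P.real {ω | counts C t ω ∘ f = b} =
      countWeight n t (Fintype.card ι) (∑ a, b a) * ∏ a, ((b a)! : ℝ)⁻¹ := by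
  classical
  have := hC.isProbabilityMeasure
  induction t generalizing b with
  | zero =>
    have hzero (ω : Ω) : counts C 0 ω ∘ f = 0 := by ext; simp [counts, copies_zero]
    rcases eq_or_ne b 0 with rfl | hb
    · simp [hzero, countWeight]
    · have hsum : 0 < ∑ a, b a := by
        simpa [Nat.pos_iff_ne_zero, funext_iff] using hb
      simp [hzero, hb.symm, countWeight, Nat.descFactorial_of_lt hsum]
  | succ t ih =>
    have hadd (a : ι) : P.real {ω | counts C t ω ∘ f + Pi.single a 1 = b} =
        b a * (countWeight n t (Fintype.card ι) ((∑ a, b a) - 1) * ∏ a, ((b a)! : ℝ)⁻¹) := by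
      rcases Nat.eq_zero_or_pos (b a) with hb | hb
      · have hempty (ω : Ω) : counts C t ω ∘ f + Pi.single a 1 ≠ b :=
          fun h => by simpa [hb] using congrFun h a
        simp [hempty, hb]
      · have hle : Pi.single a 1 ≤ b := update_le_iff.2 ⟨hb, fun _ _ => Nat.zero_le _⟩
        obtain ⟨b, rfl⟩ : ∃ b', b = b' + Pi.single a 1 :=
          ⟨b - Pi.single a 1, (tsub_add_cancel_of_le hle).symm⟩
        simp only [add_left_inj, ih, ← prod_inv_factorial_add_single b a]
        simp only [Pi.add_apply, Finset.prod_inv_distrib, Pi.single_eq_same, Nat.cast_add,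
          Nat.cast_one, Finset.sum_add_distrib, Finset.sum_pi_single', Finset.mem_univ, ↓reduceIte,
          add_tsub_cancel_right]
        ring
    rw [hC.measureReal_counts_succ_comp, ih]
    simp only [hadd]
    rw [← Finset.mul_sum, ← Finset.sum_mul, ← Nat.cast_sum]
    rcases Nat.eq_zero_or_eq_succ_pred (∑ a, b a) with h | h
    · rw [h, countWeight_succ_zero]
      simp only [Finset.prod_inv_distrib, CharP.cast_eq_zero, zero_tsub, zero_mul, mul_zero,
        add_zero]
      ring
    · rw [h, Nat.succ_eq_add_one, countWeight_succ_succ]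
      push_cast
      ring

end ExactLaw

section PoissonComparison

lemma one_sub_sq_div_mul_pow_le_descFactorial {s t : ℕ} (hst : s ≤ t) :
    (1 - (s : ℝ) ^ 2 / t) * (t : ℝ) ^ s ≤ t.descFactorial s := by
  rcases t.eq_zero_or_pos with rfl | ht
  · simp [Nat.le_zero.1 hst]
  have hst' : (s : ℝ) ≤ t := by exact_mod_cast hst
  have hdiv : (s : ℝ) / t ≤ 1 := div_le_one_of_le₀ hst' t.cast_nonneg
  have hbernoulli : 1 - (s : ℝ) ^ 2 / t ≤ (1 - (s : ℝ) / t) ^ s := by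
    have h := one_add_mul_le_pow (show -2 ≤ -((s : ℝ) / t) by linarith) s
    calc 1 - (s : ℝ) ^ 2 / t = 1 + s * (-((s : ℝ) / t)) := by ring
      _ ≤ (1 - (s : ℝ) / t) ^ s := by simpa [sub_eq_add_neg] using h
  calc (1 - (s : ℝ) ^ 2 / t) * (t : ℝ) ^ s ≤ (1 - (s : ℝ) / t) ^ s * (t : ℝ) ^ s := by gcongr
    _ = ((t : ℝ) - s) ^ s := by
        rw [← mul_pow, sub_mul, one_mul, div_mul_cancel₀ _ (by positivity)]
    _ ≤ ((t + 1 - s : ℕ) : ℝ) ^ s := by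
        have : 0 ≤ (t : ℝ) - s := sub_nonneg.2 hst'
        gcongr
        push_cast [hst.trans (Nat.le_succ t)]
        linarith
    _ ≤ t.descFactorial s := by exact_mod_cast Nat.pow_sub_le_descFactorial t s

lemma one_sub_mul_exp_neg_pow_le {x : ℝ} (hx0 : 0 ≤ x) (hx1 : x ≤ 1) (t : ℕ) :
    (1 - t * x ^ 2) * Real.exp (-x) ^ t ≤ (1 - x) ^ t := by
  have hbernoulli : 1 - t * x ^ 2 ≤ (1 - x ^ 2) ^ t := by
    have h := one_add_mul_le_pow (show -2 ≤ -x ^ 2 by nlinarith) t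
    calc 1 - t * x ^ 2 = 1 + t * (-x ^ 2) := by ring
      _ ≤ (1 - x ^ 2) ^ t := by simpa [sub_eq_neg_add, add_comm] using h
  have hexp : 1 - x ^ 2 ≤ (1 - x) * Real.exp x := by
    nlinarith [Real.add_one_le_exp x]
  calc (1 - t * x ^ 2) * Real.exp (-x) ^ t
      ≤ ((1 - x) * Real.exp x) ^ t * Real.exp (-x) ^ t := by
        gcongr
        exact hbernoulli.trans (pow_le_pow_left₀ (by nlinarith) hexp t)
    _ = (1 - x) ^ t := by
        rw [← mul_pow, mul_assoc, ← Real.exp_add, add_neg_cancel, Real.exp_zero, mul_one]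

/-- The error factor in the upper bound of the law of `r` counts, each at most `K`, by a product
of Poisson laws. -/
noncomputable def upperFactor (n K r : ℕ) : ℝ := Real.exp (r ^ 2 * K / n)

/-- The error factor in the lower bound of the law of `r` counts, each at most `K`, by a product
of Poisson laws. -/
noncomputable def lowerFactor (n t K r : ℕ) : ℝ :=
  (1 - (r * K : ℝ) ^ 2 / t) * (1 - (r : ℝ) ^ 2 * t / n ^ 2)

lemma exp_neg_div_pow (n t r : ℕ) :
    Real.exp (-(t / n)) ^ r = Real.exp (-(r / n)) ^ t := by
  rw [← Real.exp_nat_mul, ← Real.exp_nat_mul]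
  congr 1
  ring

variable {n t r s K : ℕ}

lemma countWeight_le (hn : 0 < n) (hr : r ≤ n) (hs : s ≤ r * K) :
    countWeight n t r s ≤
      upperFactor n K r * (Real.exp (-(t / n)) ^ r * ((t : ℝ) / n) ^ s) := by
  rcases lt_or_ge t s with hts | hst
  · rw [countWeight, Nat.descFactorial_of_lt hts, upperFactor]
    simp only [Nat.cast_zero, zero_mul]
    positivity
  have hn0 : (0 : ℝ) < n := by exact_mod_cast hn
  have hs' : (s : ℝ) ≤ r * K := by exact_mod_cast hs
  have hrn : (0 : ℝ) ≤ 1 - r / n :=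
    sub_nonneg.2 (div_le_one_of_le₀ (by exact_mod_cast hr) hn0.le)
  have hfact : (t.descFactorial s : ℝ) ≤ (t : ℝ) ^ s := by
    exact_mod_cast Nat.descFactorial_le_pow t s
  have hpow : (1 - (r : ℝ) / n) ^ (t - s) ≤ upperFactor n K r * Real.exp (-(t / n)) ^ r := by
    calc (1 - (r : ℝ) / n) ^ (t - s) ≤ Real.exp (-(r / n)) ^ (t - s) :=
          pow_le_pow_left₀ hrn (Real.one_sub_le_exp_neg _) _
      _ = Real.exp (r * s / n) * Real.exp (-(t / n)) ^ r := by
          rw [← Real.exp_nat_mul, ← Real.exp_nat_mul, ← Real.exp_add, Nat.cast_sub hst]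
          congr 1
          ring
      _ ≤ upperFactor n K r * Real.exp (-(t / n)) ^ r := by
          rw [upperFactor, sq, mul_assoc]
          gcongr
  calc countWeight n t r s
      ≤ (t : ℝ) ^ s * ((n : ℝ)⁻¹) ^ s * (upperFactor n K r * Real.exp (-(t / n)) ^ r) := by
        unfold countWeight
        gcongr
    _ = upperFactor n K r * (Real.exp (-(t / n)) ^ r * ((t : ℝ) / n) ^ s) := by
        rw [div_eq_mul_inv (t : ℝ), mul_pow]
        ring

lemma le_countWeight (hr : r ≤ n) (hs : s ≤ r * K) (hK : (r * K) ^ 2 ≤ t)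
    (hrt : r ^ 2 * t ≤ n ^ 2) :
    lowerFactor n t K r * (Real.exp (-(t / n)) ^ r * ((t : ℝ) / n) ^ s) ≤
      countWeight n t r s := by
  have hst : s ≤ t := hs.trans ((Nat.le_self_pow two_ne_zero _).trans hK)
  have hs' : (s : ℝ) ≤ r * K := by exact_mod_cast hs
  have hrn : (r : ℝ) / n ≤ 1 := div_le_one_of_le₀ (by exact_mod_cast hr) n.cast_nonneg
  have hfact : (1 - (r * K : ℝ) ^ 2 / t) * (t : ℝ) ^ s ≤ t.descFactorial s :=
    (by gcongr : (1 - (r * K : ℝ) ^ 2 / t) * (t : ℝ) ^ s ≤ (1 - (s : ℝ) ^ 2 / t) * t ^ s).trans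
      (one_sub_sq_div_mul_pow_le_descFactorial hst)
  have hpow : (1 - (r : ℝ) ^ 2 * t / n ^ 2) * Real.exp (-(t / n)) ^ r ≤
      (1 - (r : ℝ) / n) ^ (t - s) := by
    calc (1 - (r : ℝ) ^ 2 * t / n ^ 2) * Real.exp (-(t / n)) ^ r
        = (1 - t * ((r : ℝ) / n) ^ 2) * Real.exp (-(r / n)) ^ t := by
          rw [exp_neg_div_pow]
          ring
      _ ≤ (1 - (r : ℝ) / n) ^ t := one_sub_mul_exp_neg_pow_le (by positivity) hrn t
      _ ≤ (1 - (r : ℝ) / n) ^ (t - s) :=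
          pow_le_pow_of_le_one (sub_nonneg.2 hrn) (sub_le_self _ (by positivity)) (Nat.sub_le _ _)
  have hnonneg : 0 ≤ 1 - (r : ℝ) ^ 2 * t / n ^ 2 :=
    sub_nonneg.2 (div_le_one_of_le₀ (by exact_mod_cast hrt) (by positivity))
  calc lowerFactor n t K r * (Real.exp (-(t / n)) ^ r * ((t : ℝ) / n) ^ s)
      = ((1 - (r * K : ℝ) ^ 2 / t) * (t : ℝ) ^ s) * ((n : ℝ)⁻¹) ^ s *
          ((1 - (r : ℝ) ^ 2 * t / n ^ 2) * Real.exp (-(t / n)) ^ r) := by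
        rw [lowerFactor, div_eq_mul_inv (t : ℝ) n, mul_pow]
        ring
    _ ≤ countWeight n t r s := by
        unfold countWeight
        gcongr

variable {Ω : Type*} [MeasurableSpace Ω] {P : Measure Ω} {C : ℕ → Ω → Fin n}
  {ι : Type*} [Fintype ι] {f : ι ↪ Fin n} {B : ι → Finset ℕ}

lemma prod_poissonMeasure_real_singleton (τ : ℝ≥0) (b : ι → ℕ) :
    ∏ a, (poissonMeasure τ).real {b a} =
      Real.exp (-τ) ^ Fintype.card ι * (τ : ℝ) ^ (∑ a, b a) * ∏ a, ((b a)! : ℝ)⁻¹ := by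
  simp only [poissonMeasure_real_singleton, div_eq_mul_inv, Finset.prod_mul_distrib,
    Finset.prod_const, Finset.prod_pow_eq_pow_sum, Finset.card_univ]

variable [DecidableEq ι]

lemma prod_poissonMeasure_real (τ : ℝ≥0) (B : ι → Finset ℕ) :
    ∏ a, (poissonMeasure τ).real (B a) =
      ∑ b ∈ Fintype.piFinset B, ∏ a, (poissonMeasure τ).real {b a} := by
  simp only [← sum_measureReal_singleton, Finset.prod_univ_sum]

lemma IsCouponSequence.measureReal_counts_mem (hC : IsCouponSequence C P) :
    P.real {ω | counts C t ω ∘ f ∈ Fintype.piFinset B} =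
      ∑ b ∈ Fintype.piFinset B, P.real {ω | counts C t ω ∘ f = b} := by
  have := hC.isProbabilityMeasure
  exact (sum_measureReal_preimage_singleton _
    fun b _ => hC.measurableSet_counts t {N | N ∘ f = b}).symm

lemma sum_le_card_mul (hB : ∀ a, ∀ b ∈ B a, b ≤ K) {b : ι → ℕ} (hb : b ∈ Fintype.piFinset B) :
    ∑ a, b a ≤ Fintype.card ι * K := by
  simpa using Finset.sum_le_card_nsmul Finset.univ b K
    fun a _ => hB a _ (Fintype.mem_piFinset.1 hb a)

theorem IsCouponSequence.measureReal_counts_mem_le (hC : IsCouponSequence C P)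
    (hB : ∀ a, ∀ b ∈ B a, b ≤ K) :
    P.real {ω | counts C t ω ∘ f ∈ Fintype.piFinset B} ≤
      upperFactor n K (Fintype.card ι) * ∏ a, (poissonMeasure (t / n)).real (B a) := by
  rw [hC.measureReal_counts_mem, prod_poissonMeasure_real, Finset.mul_sum]
  refine Finset.sum_le_sum fun b hb => ?_
  rw [hC.measureReal_counts_comp_eq, prod_poissonMeasure_real_singleton, ← mul_assoc]
  gcongr
  exact_mod_cast countWeight_le hC.pos (by simpa using Fintype.card_le_of_embedding f)
    (sum_le_card_mul hB hb)

theorem IsCouponSequence.le_measureReal_counts_mem (hC : IsCouponSequence C P)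
    (hB : ∀ a, ∀ b ∈ B a, b ≤ K) (hK : (Fintype.card ι * K) ^ 2 ≤ t)
    (ht : Fintype.card ι ^ 2 * t ≤ n ^ 2) :
    lowerFactor n t K (Fintype.card ι) * ∏ a, (poissonMeasure (t / n)).real (B a) ≤
      P.real {ω | counts C t ω ∘ f ∈ Fintype.piFinset B} := by
  rw [hC.measureReal_counts_mem, prod_poissonMeasure_real, Finset.mul_sum]
  refine Finset.sum_le_sum fun b hb => ?_
  rw [hC.measureReal_counts_comp_eq, prod_poissonMeasure_real_singleton, ← mul_assoc]
  gcongr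
  exact_mod_cast le_countWeight (by simpa using Fintype.card_le_of_embedding f)
    (sum_le_card_mul hB hb) hK ht

end PoissonComparison

section TupleCount

variable {ι β γ : Type*} [Fintype ι] [Fintype β] [Fintype γ] [DecidableEq ι] [DecidableEq β]

/-- The number of elements at which `N` takes values in `D`. -/
def numWith (N : γ → ℕ) (D : Finset ℕ) : ℕ := Fintype.card {l // N l ∈ D}

/-- The number of tuples of distinct elements, indexed by `ι`, at whose `a`-th entry `N` takes
values in `B a`, for every `a`. -/
noncomputable def tupleCount (B : ι → Finset ℕ) (N : γ → ℕ) : ℕ :=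
  Nat.card {f : ι ↪ γ // N ∘ f ∈ Fintype.piFinset B}

lemma tupleCount_const (D : Finset ℕ) (N : γ → ℕ) :
    tupleCount (fun _ : β => D) N = (numWith N D).descFactorial (Fintype.card β) := by
  have e : {f : β ↪ γ // N ∘ f ∈ Fintype.piFinset fun _ => D} ≃ (β ↪ {l // N l ∈ D}) :=
    (Equiv.subtypeEquivRight fun f => by simp).trans (Equiv.codRestrict β {l | N l ∈ D})
  classical
  rw [tupleCount, Nat.card_congr e, Nat.card_eq_fintype_card, Fintype.card_embedding_eq, numWith]

lemma tupleCount_unit (D : Finset ℕ) (N : γ → ℕ) :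
    tupleCount (fun _ : Unit => D) N = numWith N D := by
  rw [tupleCount_const, Fintype.card_unit, Nat.descFactorial_one]

lemma numWith_insert {k : ℕ} {D : Finset ℕ} (hk : k ∉ D) (N : γ → ℕ) :
    numWith N (insert k D) = numWith N {k} + numWith N D := by
  simp only [numWith, Finset.mem_insert, Finset.mem_singleton]
  exact Fintype.card_subtype_or_disjoint _ _ (Pi.disjoint_iff.2 fun l => by
    simpa [disjoint_iff_inf_le] using fun h => h ▸ hk)

lemma numWith_mono (N : γ → ℕ) {D E : Finset ℕ} (h : D ⊆ E) : numWith N D ≤ numWith N E :=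
  Fintype.card_subtype_mono _ _ fun _ hl => h hl

lemma numWith_eq_sum (N : γ → ℕ) (D : Finset ℕ) :
    numWith N D = ∑ l, if N l ∈ D then 1 else 0 := by
  rw [numWith, Fintype.card_subtype, Finset.card_filter]

lemma numWith_compl_range {α : Type*} [Fintype α] (f : α ↪ γ) [DecidablePred (· ∈ Set.range f)]
    (D : Finset ℕ) (N : γ → ℕ) :
    numWith (fun l : ↑(Set.range f)ᶜ => N l) D = numWith N D - numWith (N ∘ f) D := by
  refine Nat.eq_sub_of_add_eq' ?_
  simp only [numWith_eq_sum]
  rw [← Fintype.sum_subtype_add_sum_subtype (· ∈ Set.range f)]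
  congr 1
  exact Fintype.sum_equiv (Equiv.ofInjective f f.injective) _ _ fun _ => rfl

/-- In a tuple of distinct elements whose first block is constrained by `B`, the entries of the
second block, all constrained by `D`, avoid the `q` entries of the first block with values in
`D`. -/
lemma tupleCount_sumElim_const {B : ι → Finset ℕ} {D : Finset ℕ} {q : ℕ}
    (hq : ∀ b ∈ Fintype.piFinset B, numWith b D = q) (N : γ → ℕ) :
    tupleCount (Sum.elim B fun _ : β => D) N =
      tupleCount B N * (numWith N D - q).descFactorial (Fintype.card β) := by
  classical
  let restrict (f : ι ↪ γ) (l : ↑(Set.range f)ᶜ) : ℕ := N l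
  let extensions (f : ι ↪ γ) : Type _ :=
    {g : β ↪ ↑(Set.range f)ᶜ // restrict f ∘ g ∈ Fintype.piFinset fun _ => D}
  have hsplit : {f : ι ⊕ β ↪ γ // N ∘ f ∈ Fintype.piFinset (Sum.elim B fun _ => D)} ≃
      Σ f : {f : ι ↪ γ // N ∘ f ∈ Fintype.piFinset B}, extensions f :=
    (Equiv.sumEmbeddingEquivSigmaEmbeddingRestricted.subtypeEquiv
      (q := fun p => N ∘ p.1 ∈ Fintype.piFinset B ∧
        restrict p.1 ∘ p.2 ∈ Fintype.piFinset fun _ => D)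
      fun f => by simp only [Fintype.mem_piFinset, Sum.forall]; rfl).trans
      ⟨fun x => ⟨⟨x.1.1, x.2.1⟩, ⟨x.1.2, x.2.2⟩⟩, fun x => ⟨⟨x.1.1, x.2.1⟩, x.1.2, x.2.2⟩,
        fun _ => rfl, fun _ => rfl⟩
  have hfiber (f : {f : ι ↪ γ // N ∘ f ∈ Fintype.piFinset B}) :
      Nat.card (extensions f) = (numWith N D - q).descFactorial (Fintype.card β) := by
    rw [← hq _ f.2, ← numWith_compl_range]
    exact tupleCount_const D (restrict f)
  rw [tupleCount, Nat.card_congr hsplit, Nat.card_sigma]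
  simp only [hfiber, Finset.sum_const, Finset.card_univ, smul_eq_mul, tupleCount,
    Nat.card_eq_fintype_card]

end TupleCount

section Bonferroni

lemma sum_alternating_choose_le (w R : ℕ) :
    ∑ r ∈ Finset.range (2 * R + 2), (-1 : ℝ) ^ r * (w.choose r : ℝ) ≤ if w = 0 then 1 else 0 := by
  cases w with
  | zero => simp [Finset.sum_range_succ']
  | succ w =>
    have halt : ∑ r ∈ Finset.range (2 * R + 2), (-1 : ℝ) ^ r * ((w + 1).choose r : ℝ) =
        (-1) ^ (2 * R + 1) * (w.choose (2 * R + 1) : ℝ) := by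
      exact_mod_cast Int.alternating_sum_range_choose_eq_choose (n := w) (m := 2 * R + 1)
    rw [halt, Odd.neg_one_pow ⟨R, rfl⟩]
    simp

lemma mul_sum_alternating_choose_sub_sq_le {X W U : ℕ} (hXW : X ≤ W) {Λ : ℝ} (hΛ : 0 < Λ) (R : ℕ) :
    X * (∑ r ∈ Finset.range (2 * R + 2), (-1 : ℝ) ^ r * (W - 1).choose r -
      (((U : ℝ) - Λ) / Λ) ^ 2) ≤ if X = 1 ∧ W = 1 ∧ U ≠ 0 then 1 else 0 := by
  have halt := sum_alternating_choose_le (W - 1) R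
  rcases Nat.eq_zero_or_pos X with rfl | hX
  · simp only [Nat.cast_zero, zero_mul]
    split_ifs <;> norm_num
  · rcases eq_or_ne U 0 with rfl | hU
    · have hone : (((0 : ℕ) - Λ) / Λ) ^ 2 = 1 := by field_simp; simp
      rw [hone, if_neg (by simp)]
      refine mul_nonpos_of_nonneg_of_nonpos (by positivity) ?_
      split_ifs at halt <;> linarith
    · have hdiff := sub_le_self (∑ r ∈ Finset.range (2 * R + 2), (-1 : ℝ) ^ r * (W - 1).choose r)
        (sq_nonneg (((U : ℝ) - Λ) / Λ))
      rcases eq_or_ne (W - 1) 0 with hW | hW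
      · obtain ⟨rfl, rfl⟩ : W = 1 ∧ X = 1 := by lia
        simpa [hU] using hdiff.trans halt
      · rw [if_neg (by lia)]
        rw [if_neg hW] at halt
        exact mul_nonpos_of_nonneg_of_nonpos (by positivity) (hdiff.trans halt)

/-- The constraints on a tuple with one entry equal to `c`, then `j` entries equal to `k`, then `r`
entries in `D`. -/
def tupleSets (c k j r : ℕ) (D : Finset ℕ) : (Unit ⊕ Fin j) ⊕ Fin r → Finset ℕ :=
  Sum.elim (Sum.elim (fun _ => {c}) fun _ => {k}) fun _ => D

variable {γ : Type*} [Fintype γ]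

lemma tupleCount_tupleSets {c k : ℕ} (hck : c ≠ k) (j r : ℕ) (D : Finset ℕ) (N : γ → ℕ) :
    tupleCount (tupleSets c k j r D) N =
      numWith N {c} * (numWith N {k}).descFactorial j *
        (numWith N D - ((if c ∈ D then 1 else 0) + if k ∈ D then j else 0)).descFactorial r := by
  have hunit : ∀ b ∈ Fintype.piFinset (fun _ : Unit => {c}), numWith b {k} = 0 := by
    intro b hb
    simp only [Fintype.mem_piFinset, Finset.mem_singleton] at hb
    simp [numWith_eq_sum, hb, hck]
  have hblock : ∀ b ∈ Fintype.piFinset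
      (Sum.elim (fun _ : Unit => {c}) fun _ : Fin j => {k} : Unit ⊕ Fin j → Finset ℕ),
      numWith b D = (if c ∈ D then 1 else 0) + if k ∈ D then j else 0 := by
    intro b hb
    simp only [Fintype.mem_piFinset, Sum.forall, Sum.elim_inl, Sum.elim_inr,
      Finset.mem_singleton] at hb
    simp only [numWith_eq_sum, Fintype.sum_sum_type, hb.1, hb.2]
    simp
  rw [tupleSets, tupleCount_sumElim_const hblock, tupleCount_sumElim_const hunit, tupleCount_unit,
    Nat.sub_zero, Fintype.card_fin, Fintype.card_fin]

lemma numWith_singleton_pred_le {m : ℕ} (hm : 1 ≤ m) (N : γ → ℕ) :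
    numWith N {m - 1} ≤ numWith N (Finset.range m) :=
  numWith_mono N (by simpa using Nat.pos_of_ne_zero (by lia))

lemma bonferroni_kTons_eq {m k : ℕ} (hm : 1 ≤ m) (hk : m < k) (j R : ℕ) (N : γ → ℕ) :
    ∑ r ∈ Finset.range (2 * R + 2), (-1 : ℝ) ^ r / (j ! * r ! : ℕ) *
        tupleCount (tupleSets (m - 1) k j r (insert k (Finset.range m))) N ≤
      if numWith N {m - 1} = 1 ∧ numWith N (Finset.range m) = 1 ∧ numWith N {k} = j
        then 1 else 0 := by
  have hXW := numWith_singleton_pred_le hm N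
  have hcount (r : ℕ) : (-1 : ℝ) ^ r / (j ! * r ! : ℕ) *
      tupleCount (tupleSets (m - 1) k j r (insert k (Finset.range m))) N =
      numWith N {m - 1} * (numWith N {k}).choose j * ((-1 : ℝ) ^ r *
        (numWith N {k} + numWith N (Finset.range m) - (1 + j)).choose r) := by
    rw [tupleCount_tupleSets (by lia),
      if_pos (Finset.mem_insert_of_mem (Finset.mem_range.2 (by lia))),
      if_pos (Finset.mem_insert_self _ _), numWith_insert (by simpa using hk.le),
      Nat.descFactorial_eq_factorial_mul_choose, Nat.descFactorial_eq_factorial_mul_choose]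
    push_cast
    field_simp
  generalize numWith N {m - 1} = X, numWith N (Finset.range m) = W, numWith N {k} = U at *
  simp only [hcount, ← Finset.mul_sum]
  refine (mul_le_mul_of_nonneg_left (sum_alternating_choose_le _ R) (by positivity)).trans ?_
  rcases lt_or_ge U j with hUj | hUj
  · rw [Nat.choose_eq_zero_of_lt hUj]
    split_ifs <;> simp
  · rcases Nat.eq_zero_or_pos X with rfl | hX
    · simp
    · rcases eq_or_ne (U + W - (1 + j)) 0 with h | h
      · obtain ⟨rfl, rfl, rfl⟩ : U = j ∧ W = 1 ∧ X = 1 := by lia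
        simp
      · rw [if_neg h, mul_zero]
        split_ifs <;> norm_num

/-- The subtracted bracket expands `X * (U / Λ - 1) ^ 2` in factorial moments, where `X` and `U` are
the numbers of types with `m - 1` and `k` copies. -/
lemma bonferroni_kTons_ne_zero {m k : ℕ} (hm : 1 ≤ m) (hk : m < k) {Λ : ℝ} (hΛ : 0 < Λ) (R : ℕ)
    (N : γ → ℕ) :
    ∑ r ∈ Finset.range (2 * R + 2), (-1 : ℝ) ^ r / r ! *
          tupleCount (tupleSets (m - 1) k 0 r (Finset.range m)) N -
        (1 / Λ ^ 2 * tupleCount (tupleSets (m - 1) k 0 2 {k}) N +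
          (1 / Λ ^ 2 - 2 / Λ) * tupleCount (tupleSets (m - 1) k 0 1 {k}) N +
          tupleCount (tupleSets (m - 1) k 0 0 {k}) N) ≤
      if numWith N {m - 1} = 1 ∧ numWith N (Finset.range m) = 1 ∧ numWith N {k} ≠ 0
        then 1 else 0 := by
  have hXW := numWith_singleton_pred_le hm N
  have hmk : m - 1 ≠ k := by lia
  have hmiss (r : ℕ) : (-1 : ℝ) ^ r / r ! *
      tupleCount (tupleSets (m - 1) k 0 r (Finset.range m)) N =
      numWith N {m - 1} * ((-1 : ℝ) ^ r * (numWith N (Finset.range m) - 1).choose r) := by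
    rw [tupleCount_tupleSets hmk, if_pos (Finset.mem_range.2 (by lia)),
      Nat.descFactorial_eq_factorial_mul_choose _ r]
    simp only [Nat.descFactorial_zero, mul_one, ite_self, add_zero, Nat.cast_mul]
    field_simp
  have htons (r : ℕ) : tupleCount (tupleSets (m - 1) k 0 r {k}) N =
      numWith N {m - 1} * (numWith N {k}).descFactorial r := by
    simp [tupleCount_tupleSets hmk, hmk]
  simp only [hmiss, htons, ← Finset.mul_sum]
  generalize numWith N {m - 1} = X, numWith N (Finset.range m) = W, numWith N {k} = U at *
  have hsq : 1 / Λ ^ 2 * ((X * U.descFactorial 2 : ℕ) : ℝ) +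
      (1 / Λ ^ 2 - 2 / Λ) * ((X * U.descFactorial 1 : ℕ) : ℝ) +
      ((X * U.descFactorial 0 : ℕ) : ℝ) = X * (((U : ℝ) - Λ) / Λ) ^ 2 := by
    rw [Nat.descFactorial_one, Nat.descFactorial_zero]
    push_cast [Nat.cast_descFactorial_two]
    field_simp
    ring
  rw [hsq, ← mul_sub]
  exact mul_sum_alternating_choose_sub_sq_le hXW hΛ R

end Bonferroni

section LocalBound

lemma total_kTons_eq {n m k s : ℕ} {c : ℕ → Fin n} (hm : 1 ≤ m) (hk : m < k)
    (hself : copies c s (c s) = m - 1) (hother : ∀ l, l ≠ c s → m ≤ copies c s l) :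
    total m c = s + 1 ∧ kTons m k c = numWith (copies c s) {k} := by
  have hnext : ∀ l, copies c (s + 1) l = if l = c s then m else copies c s l := by
    intro l
    rw [copies_succ]
    split_ifs <;> grind
  have hfilled : ∀ l, m ≤ copies c (s + 1) l := by
    intro l
    rw [hnext]
    split_ifs with h
    exacts [le_rfl, hother l h]
  have hT : total m c = s + 1 := by
    refine le_antisymm (Nat.sInf_le hfilled) (le_csInf ⟨s + 1, hfilled⟩ fun t ht => ?_)
    by_contra! hts
    have hmono : copies c t (c s) ≤ copies c s (c s) := copies_mono c (c s) (by lia)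
    have := ht (c s)
    lia
  refine ⟨hT, ?_⟩
  rw [kTons, hT, numWith, Fintype.card_subtype]
  congr 1
  ext l
  simp only [hnext, Finset.mem_filter, Finset.mem_univ, true_and, Finset.mem_singleton]
  split_ifs with h
  · rw [h, hself]
    lia
  · rfl

lemma le_of_numWith_range_eq_one {γ : Type*} [Fintype γ] {N : γ → ℕ} {m : ℕ} {i l : γ}
    (hN : numWith N (Finset.range m) = 1) (hi : N i < m) (hl : l ≠ i) : m ≤ N l := by
  by_contra! h
  have := Fintype.card_le_one_iff_subsingleton.1 hN.le
  exact hl (congrArg Subtype.val (Subsingleton.elim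
    (⟨l, Finset.mem_range.2 h⟩ : {l // N l ∈ Finset.range m}) ⟨i, Finset.mem_range.2 hi⟩))

variable {Ω : Type*} {n : ℕ} {C : ℕ → Ω → Fin n} [MeasurableSpace Ω] {P : Measure Ω}

lemma IsCouponSequence.measureReal_one_missing_le (hC : IsCouponSequence C P) {m k : ℕ}
    (hm : 1 ≤ m) (hk : m < k) (s : ℕ) (Q : ℕ → Prop) :
    P.real {ω | numWith (counts C s ω) {m - 1} = 1 ∧ numWith (counts C s ω) (Finset.range m) = 1 ∧
        Q (numWith (counts C s ω) {k})} ≤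
      n * P.real {ω | total m (fun t => C t ω) = s + 1 ∧ Q (kTons m k fun t => C t ω)} := by
  have := hC.isProbabilityMeasure
  have hn : (n : ℝ) ≠ 0 := by exact_mod_cast hC.pos.ne'
  let A (i : Fin n) : Set (Fin n → ℕ) :=
    {N | N i = m - 1 ∧ (∀ l, l ≠ i → m ≤ N l) ∧ Q (numWith N {k})}
  let E (i : Fin n) : Set Ω := {ω | counts C s ω ∈ A i ∧ C s ω = i}
  have hmissing : {ω | numWith (counts C s ω) {m - 1} = 1 ∧
      numWith (counts C s ω) (Finset.range m) = 1 ∧ Q (numWith (counts C s ω) {k})} ⊆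
      ⋃ i ∈ Finset.univ, {ω | counts C s ω ∈ A i} := by
    rintro ω ⟨hX, hW, hQ⟩
    obtain ⟨⟨i, hi⟩, -⟩ := Fintype.card_eq_one_iff.1 hX
    rw [Finset.mem_singleton] at hi
    exact Set.mem_biUnion (Finset.mem_univ i)
      ⟨hi, fun l hl => le_of_numWith_range_eq_one hW (by lia) hl, hQ⟩
  have hcompleted : ⋃ i ∈ Finset.univ, E i ⊆
      {ω | total m (fun t => C t ω) = s + 1 ∧ Q (kTons m k fun t => C t ω)} := by
    refine Set.iUnion₂_subset fun i _ ω ⟨⟨hself, hother, hQ⟩, hi⟩ => ?_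
    subst hi
    obtain ⟨hT, hS⟩ := total_kTons_eq (c := fun t => C t ω) hm hk hself hother
    exact ⟨hT, hS ▸ hQ⟩
  calc _ ≤ ∑ i, P.real {ω | counts C s ω ∈ A i} :=
        (measureReal_mono hmissing (measure_ne_top _ _)).trans (measureReal_biUnion_finset_le _ _)
    _ = ∑ i, n * P.real (E i) := by
        refine Finset.sum_congr rfl fun i _ => ?_
        rw [hC.measureReal_counts_inter, mul_div_cancel₀ _ hn]
    _ = n * P.real (⋃ i ∈ Finset.univ, E i) := by
        rw [← Finset.mul_sum, measureReal_biUnion_finset]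
        · exact fun i _ j _ hij => Set.disjoint_left.2 fun ω hi hj => hij (hi.2.symm.trans hj.2)
        · exact fun i _ => (hC.measurableSet_counts s (A i)).inter
            (hC.measurable s (measurableSet_singleton i))
    _ ≤ _ := by gcongr; exact measure_ne_top _ _

lemma IsCouponSequence.integrable_comp_counts (hC : IsCouponSequence C P) (t : ℕ)
    (f : (Fin n → ℕ) → ℝ) : Integrable (fun ω => f (counts C t ω)) P := by
  have := hC.isProbabilityMeasure
  have hle (ω : Ω) : counts C t ω ∈ Finset.Iic fun _ : Fin n => t :=
    Finset.mem_Iic.2 fun i => (Finset.card_filter_le _ _).trans (Finset.card_range t).le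
  refine Integrable.of_bound
    ((Measurable.of_discrete (f := f)).comp (hC.measurable_counts t)).aestronglyMeasurable
    (∑ b ∈ Finset.Iic fun _ : Fin n => t, ‖f b‖) (Eventually.of_forall fun ω => ?_)
  exact Finset.single_le_sum (f := fun b => ‖f b‖) (fun _ _ => norm_nonneg _) (hle ω)

lemma IsCouponSequence.integral_le_of_le_one_missing (hC : IsCouponSequence C P) {m k : ℕ}
    (hm : 1 ≤ m) (hk : m < k) (s : ℕ) (Q : ℕ → Prop) [DecidablePred Q] {f : (Fin n → ℕ) → ℝ}
    (hf : ∀ N, f N ≤ if numWith N {m - 1} = 1 ∧ numWith N (Finset.range m) = 1 ∧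
      Q (numWith N {k}) then 1 else 0) :
    ∫ ω, f (counts C s ω) ∂P ≤
      n * P.real {ω | total m (fun t => C t ω) = s + 1 ∧ Q (kTons m k fun t => C t ω)} := by
  let A : Set (Fin n → ℕ) :=
    {N | numWith N {m - 1} = 1 ∧ numWith N (Finset.range m) = 1 ∧ Q (numWith N {k})}
  calc ∫ ω, f (counts C s ω) ∂P ≤ ∫ ω, A.indicator 1 (counts C s ω) ∂P :=
        integral_mono (hC.integrable_comp_counts s f) (hC.integrable_comp_counts s _)
          fun ω => (hf _).trans_eq (by simp [A, Set.indicator_apply])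
    _ = P.real {ω | counts C s ω ∈ A} := integral_indicator_one (hC.measurableSet_counts s A)
    _ ≤ _ := hC.measureReal_one_missing_le hm hk s Q

theorem IsCouponSequence.sum_integral_tupleCount_le (hC : IsCouponSequence C P) {m k : ℕ}
    (hm : 1 ≤ m) (hk : m < k) (s j R : ℕ) :
    ∑ r ∈ Finset.range (2 * R + 2), (-1 : ℝ) ^ r / (j ! * r ! : ℕ) *
        ∫ ω, (tupleCount (tupleSets (m - 1) k j r (insert k (Finset.range m)))
          (counts C s ω) : ℝ) ∂P ≤
      n * P.real {ω | total m (fun t => C t ω) = s + 1 ∧ kTons m k (fun t => C t ω) = j} := by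
  have hbound := hC.integral_le_of_le_one_missing hm hk s (fun u => u = j)
    (bonferroni_kTons_eq hm hk j R)
  rw [integral_finsetSum _ fun r _ => hC.integrable_comp_counts s fun N =>
    (-1 : ℝ) ^ r / (j ! * r ! : ℕ) * tupleCount _ N] at hbound
  simpa only [integral_const_mul] using hbound

theorem IsCouponSequence.sum_integral_tupleCount_sub_le (hC : IsCouponSequence C P) {m k : ℕ}
    (hm : 1 ≤ m) (hk : m < k) {Λ : ℝ} (hΛ : 0 < Λ) (s R : ℕ) :
    ∑ r ∈ Finset.range (2 * R + 2), (-1 : ℝ) ^ r / r ! *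
        ∫ ω, (tupleCount (tupleSets (m - 1) k 0 r (Finset.range m)) (counts C s ω) : ℝ) ∂P -
      (1 / Λ ^ 2 * ∫ ω, (tupleCount (tupleSets (m - 1) k 0 2 {k}) (counts C s ω) : ℝ) ∂P +
        (1 / Λ ^ 2 - 2 / Λ) *
          ∫ ω, (tupleCount (tupleSets (m - 1) k 0 1 {k}) (counts C s ω) : ℝ) ∂P +
        ∫ ω, (tupleCount (tupleSets (m - 1) k 0 0 {k}) (counts C s ω) : ℝ) ∂P) ≤
      n * P.real {ω | total m (fun t => C t ω) = s + 1 ∧ kTons m k (fun t => C t ω) ≠ 0} := by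
  refine le_trans (le_of_eq ?_) (hC.integral_le_of_le_one_missing hm hk s (fun u => u ≠ 0)
    (bonferroni_kTons_ne_zero hm hk hΛ R))
  have hint (D : Finset ℕ) (r : ℕ) : Integrable
      (fun ω => (tupleCount (tupleSets (m - 1) k 0 r D) (counts C s ω) : ℝ)) P :=
    hC.integrable_comp_counts s fun N => (tupleCount (tupleSets (m - 1) k 0 r D) N : ℝ)
  rw [integral_sub (by fun_prop) (by fun_prop), integral_finsetSum _ (by fun_prop),
    integral_add (by fun_prop) (by fun_prop), integral_add (by fun_prop) (by fun_prop)]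
  simp only [integral_const_mul]

end LocalBound

section PoissonAsymptotics

open Asymptotics

lemma exp_mul_poissonMeasure_real_singleton {L : ℝ} (hL : 0 < L) (τ : ℝ≥0) (b c : ℕ) :
    Real.exp L * (poissonMeasure τ).real {b} =
      Real.exp (-(τ - (L + c * Real.log L))) * (τ / L) ^ b * (L ^ b / L ^ c) / b ! := by
  have hexp : Real.exp (-(τ - (L + c * Real.log L))) = Real.exp L * Real.exp (-τ) * L ^ c := by
    rw [← Real.exp_log (pow_pos hL c), Real.log_pow, ← Real.exp_add, ← Real.exp_add]
    congr 1
    ring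
  rw [hexp, poissonMeasure_real_singleton, div_pow]
  field_simp

lemma mul_log_div_sub_mem_Icc {κ T : ℝ} (hκ : 0 < κ) (hT : 0 < T) :
    κ * Real.log (κ / T) - (κ - T) ∈ Set.Icc 0 ((κ - T) ^ 2 / T) := by
  have hy : 0 < κ / T := div_pos hκ hT
  constructor
  · have hlow := mul_le_mul_of_nonneg_left (Real.one_sub_inv_le_log_of_pos hy) hκ.le
    have heq : κ * (1 - (κ / T)⁻¹) = κ - T := by field_simp
    linarith
  · have hup := mul_le_mul_of_nonneg_left (Real.log_le_sub_one_of_pos hy) hκ.le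
    have heq : κ * (κ / T - 1) - (κ - T) = (κ - T) ^ 2 / T := by field_simp
    linarith

lemma factorial_eq_stirlingSeq_mul {k : ℕ} (hk : 0 < k) :
    (k ! : ℝ) = Stirling.stirlingSeq k * (√(2 * k) * (k / Real.exp 1) ^ k) := by
  rw [Stirling.stirlingSeq]
  field_simp

lemma pow_div_pow_eq_exp_neg {τ κ : ℝ} (hτ : 0 < τ) (hκ : 0 < κ) (k : ℕ) :
    τ ^ k / (κ / Real.exp 1) ^ k = Real.exp (-(k * Real.log (κ / (Real.exp 1 * τ)))) := by
  rw [← div_pow, ← Real.exp_log (pow_pos (by positivity : 0 < τ / (κ / Real.exp 1)) k),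
    Real.log_pow, ← mul_neg, ← Real.log_inv]
  congr 3
  field_simp

lemma sqrt_two_mul_eq {L : ℝ} (hL : 0 < L) (κ : ℝ) :
    √(2 * κ) = √2 * √(κ / L) * Real.exp (Real.log L / 2) := by
  rw [← Real.log_sqrt hL.le, Real.exp_log (Real.sqrt_pos.2 hL), mul_assoc,
    ← Real.sqrt_mul' _ hL.le, div_mul_cancel₀ _ hL.ne', Real.sqrt_mul (by norm_num)]

/-- The quantity `k * log (k / (e * τ)) - (k - e * τ)`, by which the exponent of the Poisson weight
at `k` differs, in Stirling's approximation, from its value when `k = e * τ`. -/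
noncomputable def stirlingDiscrepancy (k : ℕ) (τ : ℝ) : ℝ :=
  k * Real.log (k / (Real.exp 1 * τ)) - (k - Real.exp 1 * τ)

lemma exp_mul_poissonMeasure_real_singleton_mul_exp {L δ : ℝ} {τ : ℝ≥0} {c k : ℕ} (hL : 0 < L)
    (hτ : 0 < τ) (hk : 0 < k)
    (hkL : (k : ℝ) = Real.exp 1 * L + ((Real.exp 1 - 1) * c - 1 / 2) * Real.log L + δ) :
    Real.exp L * (poissonMeasure τ).real {k} * Real.exp δ =
      Real.exp ((Real.exp 1 - 1) * (τ - (L + c * Real.log L))) *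
        Real.exp (-stirlingDiscrepancy k τ) / (√2 * √(k / L) * Stirling.stirlingSeq k) := by
  have hS : Stirling.stirlingSeq k ≠ 0 := by
    unfold Stirling.stirlingSeq
    positivity
  calc Real.exp L * (poissonMeasure τ).real {k} * Real.exp δ
      = Real.exp L * Real.exp (-τ) * (τ ^ k / (k / Real.exp 1) ^ k) * Real.exp δ /
          (√(2 * k) * Stirling.stirlingSeq k) := by
        rw [poissonMeasure_real_singleton, factorial_eq_stirlingSeq_mul hk]
        field_simp
    _ = (Real.exp L * Real.exp (-τ) * Real.exp (-(k * Real.log (k / (Real.exp 1 * τ)))) *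
          Real.exp δ * Real.exp (-(Real.log L / 2))) /
          (√2 * √(k / L) * Stirling.stirlingSeq k) := by
        rw [pow_div_pow_eq_exp_neg (by exact_mod_cast hτ) (by exact_mod_cast hk),
          sqrt_two_mul_eq hL, Real.exp_neg (Real.log L / 2)]
        field_simp
    _ = _ := by
        simp only [← Real.exp_add, stirlingDiscrepancy]
        congr 2
        linear_combination -hkL

variable {ι : Type*} {l : Filter ι} {L δ : ι → ℝ} {τ : ι → ℝ≥0} {k : ι → ℕ} {c : ℕ} {x β : ℝ}

lemma isLittleO_log_comp (hL : Tendsto L l atTop) : (fun i => Real.log (L i)) =o[l] L :=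
  Real.isLittleO_log_id_atTop.comp_tendsto hL

lemma tendsto_div_of_eq_mul_add_isLittleO {u v : ι → ℝ} {b : ℝ} (hL : Tendsto L l atTop)
    (hu : ∀ᶠ i in l, u i = b * L i + v i) (hv : v =o[l] L) :
    Tendsto (fun i => u i / L i) l (𝓝 b) := by
  have h := hv.tendsto_div_nhds_zero.const_add b
  rw [add_zero] at h
  refine h.congr' ?_
  filter_upwards [hL.eventually_gt_atTop 0, hu] with i hi hui
  rw [hui]
  field_simp

lemma isLittleO_of_tendsto_of_atTop {u v : ι → ℝ} {y : ℝ} (hu : Tendsto u l (𝓝 y))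
    (hv : Tendsto v l atTop) : u =o[l] v :=
  (hu.isBigO_one ℝ).trans_isLittleO
    (isLittleO_const_left.2 (Or.inr (tendsto_norm_atTop_atTop.comp hv)))

lemma tendsto_div_of_tendsto_sub (hL : Tendsto L l atTop)
    (hτ : Tendsto (fun i => τ i - (L i + c * Real.log (L i))) l (𝓝 x)) :
    Tendsto (fun i => τ i / L i) l (𝓝 1) :=
  tendsto_div_of_eq_mul_add_isLittleO hL (v := fun i => c * Real.log (L i) +
      (τ i - (L i + c * Real.log (L i)))) (Eventually.of_forall fun i => by ring)
    (((isLittleO_log_comp hL).const_mul_left _).add (isLittleO_of_tendsto_of_atTop hτ hL))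

lemma tendsto_div_exp_one (hL : Tendsto L l atTop)
    (hk : ∀ᶠ i in l, (k i : ℝ) = Real.exp 1 * L i + β * Real.log (L i) + δ i)
    (hδ : δ =o[l] fun i => Real.log (L i)) :
    Tendsto (fun i => (k i : ℝ) / L i) l (𝓝 (Real.exp 1)) :=
  tendsto_div_of_eq_mul_add_isLittleO hL (v := fun i => β * Real.log (L i) + δ i)
    (hk.mono fun i hi => by rw [hi, add_assoc])
    (((isLittleO_log_comp hL).const_mul_left _).add (hδ.trans (isLittleO_log_comp hL)))

lemma tendsto_atTop_of_tendsto_div {u : ι → ℝ} {b : ℝ} (hL : Tendsto L l atTop) (hb : 0 < b)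
    (hu : Tendsto (fun i => u i / L i) l (𝓝 b)) : Tendsto u l atTop := by
  refine (hu.pos_mul_atTop hb hL).congr' ?_
  filter_upwards [hL.eventually_gt_atTop 0] with i hi
  exact div_mul_cancel₀ _ hi.ne'

lemma tendsto_exp_mul_poissonMeasure_real_singleton (hL : Tendsto L l atTop)
    (hτ : Tendsto (fun i => τ i - (L i + c * Real.log (L i))) l (𝓝 x)) {b : ℕ} (hb : b ≤ c) :
    Tendsto (fun i => Real.exp (L i) * (poissonMeasure (τ i)).real {b}) l
      (𝓝 (if b = c then Real.exp (-x) / c ! else 0)) := by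
  have hpow : Tendsto (fun i => L i ^ b / L i ^ c) l (𝓝 (if b = c then 1 else 0)) := by
    split_ifs with h
    · subst h
      refine tendsto_const_nhds.congr' ?_
      filter_upwards [hL.eventually_gt_atTop 0] with i hi
      field_simp
    · exact (tendsto_pow_div_pow_atTop_zero (lt_of_le_of_ne hb h)).comp hL
  have hlim := ((((Real.continuous_exp.tendsto _).comp hτ.neg).mul
    ((tendsto_div_of_tendsto_sub hL hτ).pow b)).mul hpow).div_const (b ! : ℝ)
  have hval : Real.exp (-x) * 1 ^ b * (if b = c then 1 else 0) / (b ! : ℝ) =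
      if b = c then Real.exp (-x) / c ! else 0 := by
    split_ifs with h <;> simp [h]
  rw [hval] at hlim
  refine hlim.congr' ?_
  filter_upwards [hL.eventually_gt_atTop 0] with i hi
  exact (exp_mul_poissonMeasure_real_singleton hi (τ i) b c).symm

lemma tendsto_exp_mul_poissonMeasure_real_range (hL : Tendsto L l atTop)
    (hτ : Tendsto (fun i => τ i - (L i + c * Real.log (L i))) l (𝓝 x)) :
    Tendsto (fun i => Real.exp (L i) * (poissonMeasure (τ i)).real (Finset.range (c + 1))) l
      (𝓝 (Real.exp (-x) / c !)) := by
  simp only [← sum_measureReal_singleton, Finset.mul_sum]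
  have h := tendsto_finsetSum (Finset.range (c + 1)) fun b hb =>
    tendsto_exp_mul_poissonMeasure_real_singleton hL hτ (Nat.lt_succ_iff.1 (Finset.mem_range.1 hb))
  simpa using h

lemma isBigO_sub_exp_one_mul_log (hL : Tendsto L l atTop)
    (hτ : Tendsto (fun i => τ i - (L i + c * Real.log (L i))) l (𝓝 x))
    (hk : ∀ᶠ i in l, (k i : ℝ) = Real.exp 1 * L i + β * Real.log (L i) + δ i)
    (hδ : δ =o[l] fun i => Real.log (L i)) :
    (fun i => (k i : ℝ) - Real.exp 1 * τ i) =O[l] fun i => Real.log (L i) := by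
  have hdiff : (fun i => (β - Real.exp 1 * c) * Real.log (L i) + δ i -
      Real.exp 1 * (τ i - (L i + c * Real.log (L i)))) =O[l] fun i => Real.log (L i) :=
    ((isBigO_const_mul_self _ _ _).add hδ.isBigO).sub (isLittleO_of_tendsto_of_atTop
      (hτ.const_mul _) (Real.tendsto_log_atTop.comp hL)).isBigO
  refine hdiff.congr' ?_ EventuallyEq.rfl
  filter_upwards [hk] with i hi
  rw [hi]
  ring

lemma tendsto_stirlingDiscrepancy (hL : Tendsto L l atTop)
    (hτ : Tendsto (fun i => τ i - (L i + c * Real.log (L i))) l (𝓝 x))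
    (hk : ∀ᶠ i in l, (k i : ℝ) = Real.exp 1 * L i + β * Real.log (L i) + δ i)
    (hδ : δ =o[l] fun i => Real.log (L i)) :
    Tendsto (fun i => stirlingDiscrepancy (k i) (τ i)) l (𝓝 0) := by
  have hτL := tendsto_div_of_tendsto_sub hL hτ
  have hτ0 := (tendsto_atTop_of_tendsto_div hL one_pos hτL).eventually_gt_atTop 0
  have hk0 := (tendsto_atTop_of_tendsto_div hL (Real.exp_pos 1)
    (tendsto_div_exp_one hL hk hδ)).eventually_gt_atTop 0
  have hsq : Tendsto (fun i => ((k i : ℝ) - Real.exp 1 * τ i) ^ 2 / (Real.exp 1 * τ i)) l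
      (𝓝 0) := by
    have hnum : (fun i => ((k i : ℝ) - Real.exp 1 * τ i) ^ 2) =o[l] L :=
      ((isBigO_sub_exp_one_mul_log hL hτ hk hδ).pow 2).trans_isLittleO
        ((Real.isLittleO_pow_log_id_atTop (n := 2)).comp_tendsto hL)
    have h := hnum.tendsto_div_nhds_zero.div (hτL.const_mul (Real.exp 1)) (by simp)
    rw [zero_div] at h
    refine h.congr' ?_
    filter_upwards [hL.eventually_gt_atTop 0, hτ0] with i hi hτi
    simp only [Pi.div_apply]
    field_simp
  have hmem : ∀ᶠ i in l, stirlingDiscrepancy (k i) (τ i) ∈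
      Set.Icc 0 (((k i : ℝ) - Real.exp 1 * τ i) ^ 2 / (Real.exp 1 * τ i)) := by
    filter_upwards [hτ0, hk0] with i hτi hki
    exact mul_log_div_sub_mem_Icc hki (by positivity)
  exact tendsto_of_tendsto_of_tendsto_of_le_of_le' tendsto_const_nhds hsq
    (hmem.mono fun i hi => hi.1) (hmem.mono fun i hi => hi.2)

lemma tendsto_exp_mul_poissonMeasure_real_singleton_mul_exp (hL : Tendsto L l atTop)
    (hτ : Tendsto (fun i => τ i - (L i + c * Real.log (L i))) l (𝓝 x))
    (hk : ∀ᶠ i in l, (k i : ℝ) =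
      Real.exp 1 * L i + ((Real.exp 1 - 1) * c - 1 / 2) * Real.log (L i) + δ i)
    (hδ : δ =o[l] fun i => Real.log (L i)) :
    Tendsto (fun i => Real.exp (L i) * (poissonMeasure (τ i)).real {k i} * Real.exp (δ i)) l
      (𝓝 (Real.exp ((Real.exp 1 - 1) * x) / √(2 * Real.pi * Real.exp 1))) := by
  have hτtop := tendsto_atTop_of_tendsto_div hL one_pos (tendsto_div_of_tendsto_sub hL hτ)
  have hkL := tendsto_div_exp_one hL hk hδ
  have hktop : Tendsto k l atTop := tendsto_natCast_atTop_iff.1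
    (tendsto_atTop_of_tendsto_div hL (Real.exp_pos 1) hkL)
  have hlim := (((Real.continuous_exp.tendsto _).comp (hτ.const_mul (Real.exp 1 - 1))).mul
    ((Real.continuous_exp.tendsto _).comp (tendsto_stirlingDiscrepancy hL hτ hk hδ).neg)).div
    (((Real.continuous_sqrt.tendsto _).comp hkL).const_mul (√2) |>.mul
      (Stirling.tendsto_stirlingSeq_sqrt_pi.comp hktop)) (by positivity)
  have hval : Real.exp ((Real.exp 1 - 1) * x) * Real.exp (-0) /
      (√2 * √(Real.exp 1) * √Real.pi) =
      Real.exp ((Real.exp 1 - 1) * x) / √(2 * Real.pi * Real.exp 1) := by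
    rw [neg_zero, Real.exp_zero, mul_one, Real.sqrt_mul (by positivity), Real.sqrt_mul (by simp)]
    congr 1
    ring
  rw [hval] at hlim
  refine hlim.congr' ?_
  filter_upwards [hL.eventually_gt_atTop 0, hτtop.eventually_gt_atTop 0,
    hktop.eventually_gt_atTop 0, hk] with i hLi hτi hki hi
  exact (exp_mul_poissonMeasure_real_singleton_mul_exp hLi (by exact_mod_cast hτi) hki hi).symm

end PoissonAsymptotics

section TupleCountMean

variable {Ω : Type*} {n : ℕ} {C : ℕ → Ω → Fin n} [MeasurableSpace Ω] {P : Measure Ω}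
  {α : Type*} [Fintype α] [DecidableEq α] {B : α → Finset ℕ} {K t : ℕ}

lemma IsCouponSequence.integral_tupleCount (hC : IsCouponSequence C P) (t : ℕ)
    (B : α → Finset ℕ) :
    ∫ ω, (tupleCount B (counts C t ω) : ℝ) ∂P =
      ∑ f : α ↪ Fin n, P.real {ω | counts C t ω ∘ f ∈ Fintype.piFinset B} := by
  let A (f : α ↪ Fin n) : Set (Fin n → ℕ) := {N | N ∘ f ∈ Fintype.piFinset B}
  have hcount (N : Fin n → ℕ) : (tupleCount B N : ℝ) = ∑ f, (A f).indicator 1 N := by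
    simp [tupleCount, A, Fintype.card_subtype, Set.indicator_apply, Finset.sum_boole]
  simp only [hcount]
  rw [integral_finsetSum _ fun f _ => hC.integrable_comp_counts t ((A f).indicator 1)]
  exact Finset.sum_congr rfl fun f _ => integral_indicator_one (hC.measurableSet_counts t (A f))

lemma IsCouponSequence.integral_tupleCount_le (hC : IsCouponSequence C P)
    (hB : ∀ a, ∀ b ∈ B a, b ≤ K) :
    ∫ ω, (tupleCount B (counts C t ω) : ℝ) ∂P ≤
      upperFactor n K (Fintype.card α) * (n.descFactorial (Fintype.card α) *
        ∏ a, (poissonMeasure (t / n)).real (B a)) := by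
  rw [hC.integral_tupleCount]
  refine (Finset.sum_le_card_nsmul _ _ _ fun f _ => hC.measureReal_counts_mem_le hB).trans_eq ?_
  simp only [Finset.card_univ, Fintype.card_embedding_eq, Fintype.card_fin, nsmul_eq_mul]
  ring

lemma IsCouponSequence.le_integral_tupleCount (hC : IsCouponSequence C P)
    (hB : ∀ a, ∀ b ∈ B a, b ≤ K) (hK : (Fintype.card α * K) ^ 2 ≤ t)
    (ht : Fintype.card α ^ 2 * t ≤ n ^ 2) :
    lowerFactor n t K (Fintype.card α) * (n.descFactorial (Fintype.card α) *
        ∏ a, (poissonMeasure (t / n)).real (B a)) ≤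
      ∫ ω, (tupleCount B (counts C t ω) : ℝ) ∂P := by
  rw [hC.integral_tupleCount]
  refine le_trans (le_of_eq ?_)
    (Finset.card_nsmul_le_sum _ _ _ fun f _ => hC.le_measureReal_counts_mem hB hK ht)
  simp only [Finset.card_univ, Fintype.card_embedding_eq, Fintype.card_fin, nsmul_eq_mul]
  ring

end TupleCountMean

section TupleCountLimit

open Asymptotics

variable {ι : Type*} {l : Filter ι} {n s k : ι → ℕ} {e : ℝ}

lemma tendsto_log_natCast (hn : Tendsto n l atTop) :
    Tendsto (fun i => Real.log (n i)) l atTop :=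
  Real.tendsto_log_atTop.comp (tendsto_natCast_atTop_atTop.comp hn)

lemma tendsto_log_div_self (hn : Tendsto n l atTop) :
    Tendsto (fun i => Real.log (n i) / n i) l (𝓝 0) :=
  Real.isLittleO_log_id_atTop.tendsto_div_nhds_zero.comp (tendsto_natCast_atTop_atTop.comp hn)

lemma eventually_pos_and_log_pos (hn : Tendsto n l atTop) :
    ∀ᶠ i in l, 0 < (n i : ℝ) ∧ 0 < Real.log (n i) :=
  ((tendsto_natCast_atTop_atTop.comp hn).eventually_gt_atTop 0).and
    ((tendsto_log_natCast hn).eventually_gt_atTop 0)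

lemma tendsto_mul_sq_div (hn : Tendsto n l atTop)
    (hs : Tendsto (fun i => (s i : ℝ) / n i / Real.log (n i)) l (𝓝 1))
    (hk : Tendsto (fun i => (k i : ℝ) / Real.log (n i)) l (𝓝 e)) (r : ℕ) :
    Tendsto (fun i => (r * k i : ℝ) ^ 2 / s i) l (𝓝 0) := by
  have h := ((hk.pow 2).mul (tendsto_log_div_self hn)).div hs one_ne_zero |>.const_mul ((r : ℝ) ^ 2)
  simp only [mul_zero, zero_div] at h
  refine h.congr' ?_
  filter_upwards [eventually_pos_and_log_pos hn] with i ⟨hni, hlog⟩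
  simp only [Pi.div_apply]
  rcases eq_or_ne (s i : ℝ) 0 with hsi | hsi
  · simp [hsi]
  · field_simp

lemma tendsto_sq_mul_div_sq (hn : Tendsto n l atTop)
    (hs : Tendsto (fun i => (s i : ℝ) / n i / Real.log (n i)) l (𝓝 1)) (r : ℕ) :
    Tendsto (fun i => (r : ℝ) ^ 2 * s i / (n i : ℝ) ^ 2) l (𝓝 0) := by
  have h := (hs.mul (tendsto_log_div_self hn)).const_mul ((r : ℝ) ^ 2)
  simp only [mul_zero] at h
  refine h.congr' ?_
  filter_upwards [eventually_pos_and_log_pos hn] with i ⟨hni, hlog⟩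
  field_simp

lemma tendsto_lowerFactor (hn : Tendsto n l atTop)
    (hs : Tendsto (fun i => (s i : ℝ) / n i / Real.log (n i)) l (𝓝 1))
    (hk : Tendsto (fun i => (k i : ℝ) / Real.log (n i)) l (𝓝 e)) (r : ℕ) :
    Tendsto (fun i => lowerFactor (n i) (s i) (k i) r) l (𝓝 1) := by
  simpa [lowerFactor] using ((tendsto_mul_sq_div hn hs hk r).const_sub 1).mul
    ((tendsto_sq_mul_div_sq hn hs r).const_sub 1)

lemma tendsto_upperFactor (hn : Tendsto n l atTop)
    (hk : Tendsto (fun i => (k i : ℝ) / Real.log (n i)) l (𝓝 e)) (r : ℕ) :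
    Tendsto (fun i => upperFactor (n i) (k i) r) l (𝓝 1) := by
  have hexponent := (hk.mul (tendsto_log_div_self hn)).const_mul ((r : ℝ) ^ 2)
  simp only [mul_zero] at hexponent
  have hexp := (Real.continuous_exp.tendsto _).comp hexponent
  rw [Real.exp_zero] at hexp
  refine hexp.congr' ?_
  filter_upwards [eventually_pos_and_log_pos hn] with i ⟨hni, hlog⟩
  simp only [upperFactor, Function.comp_apply]
  congr 1
  field_simp

lemma eventually_le_of_tendsto_div {u v : ι → ℕ}
    (h : Tendsto (fun i => (u i : ℝ) / v i) l (𝓝 0)) (hv : ∀ᶠ i in l, 0 < v i) :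
    ∀ᶠ i in l, u i ≤ v i := by
  filter_upwards [h.eventually (gt_mem_nhds one_pos), hv] with i hlt hvi
  rw [div_lt_one (by exact_mod_cast hvi)] at hlt
  exact_mod_cast hlt.le

variable {α : Type*} [Fintype α]

lemma tendsto_descFactorial_mul_prod (hn : Tendsto n l atTop) {p : ι → α → ℝ} {v : α → ℝ}
    (hp : ∀ a, Tendsto (fun i => n i * p i a) l (𝓝 (v a))) :
    Tendsto (fun i => (n i).descFactorial (Fintype.card α) * ∏ a, p i a) l (𝓝 (∏ a, v a)) := by
  have hratio : Tendsto (fun i => ((n i).descFactorial (Fintype.card α) : ℝ) /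
      (n i : ℝ) ^ Fintype.card α) l (𝓝 1) :=
    ((isEquivalent_iff_tendsto_one (by
      filter_upwards [eventually_gt_atTop 0] with N hN
      positivity)).1 (isEquivalent_descFactorial _)).comp hn
  have hlim := hratio.mul (tendsto_finsetProd Finset.univ fun a _ => hp a)
  rw [one_mul] at hlim
  refine hlim.congr' ?_
  filter_upwards [hn.eventually_gt_atTop 0] with i hi
  rw [Finset.prod_mul_distrib, Finset.prod_const, Finset.card_univ]
  field_simp

variable [DecidableEq α] {Ω : ι → Type*} [∀ i, MeasurableSpace (Ω i)] {P : ∀ i, Measure (Ω i)}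
  {C : ∀ i, ℕ → Ω i → Fin (n i)}

theorem tendsto_integral_tupleCount (hC : ∀ i, IsCouponSequence (C i) (P i))
    (hn : Tendsto n l atTop)
    (hs : Tendsto (fun i => (s i : ℝ) / n i / Real.log (n i)) l (𝓝 1))
    (hk : Tendsto (fun i => (k i : ℝ) / Real.log (n i)) l (𝓝 e)) {B : ι → α → Finset ℕ}
    (hB : ∀ᶠ i in l, ∀ a, ∀ b ∈ B i a, b ≤ k i) {w : ι → α → ℝ} (hw : ∀ i a, 0 ≤ w i a)
    {v : α → ℝ} (hv : ∀ a, Tendsto (fun i =>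
      n i * (w i a * (poissonMeasure (s i / n i)).real (B i a))) l (𝓝 (v a))) :
    Tendsto (fun i => (∏ a, w i a) *
      ∫ ω, (tupleCount (B i) (counts (C i) (s i) ω) : ℝ) ∂P i) l (𝓝 (∏ a, v a)) := by
  let r := Fintype.card α
  have hmean := tendsto_descFactorial_mul_prod hn hv
  simp only [Finset.prod_mul_distrib] at hmean
  have hlow := (tendsto_lowerFactor hn hs hk r).mul hmean
  have hup := (tendsto_upperFactor hn hk r).mul hmean
  rw [one_mul] at hlow hup
  have hspos : ∀ᶠ i in l, 0 < s i := by
    filter_upwards [hs.eventually (lt_mem_nhds one_pos)] with i hi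
    exact Nat.pos_of_ne_zero fun h => by simp [h] at hi
  have hrk : ∀ᶠ i in l, (r * k i) ^ 2 ≤ s i :=
    eventually_le_of_tendsto_div (by simpa using tendsto_mul_sq_div hn hs hk r) hspos
  have hrs : ∀ᶠ i in l, r ^ 2 * s i ≤ n i ^ 2 :=
    eventually_le_of_tendsto_div (by simpa using tendsto_sq_mul_div_sq hn hs r)
      ((hn.eventually_gt_atTop 0).mono fun i hi => by positivity)
  refine tendsto_of_tendsto_of_tendsto_of_le_of_le' hlow hup ?_ ?_
  · filter_upwards [hB, hrk, hrs] with i hBi hrki hrsi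
    rw [mul_left_comm _ (∏ a, w i a), mul_left_comm _ (∏ a, w i a)]
    exact mul_le_mul_of_nonneg_left ((hC i).le_integral_tupleCount hBi hrki hrsi)
      (Finset.prod_nonneg fun a _ => hw i a)
  · filter_upwards [hB] with i hBi
    rw [mul_left_comm _ (∏ a, w i a), mul_left_comm _ (∏ a, w i a)]
    exact mul_le_mul_of_nonneg_left ((hC i).integral_tupleCount_le hBi)
      (Finset.prod_nonneg fun a _ => hw i a)

end TupleCountLimit

section LocalLimit

lemma tendsto_sum_alternating (y : ℝ) :
    Tendsto (fun R : ℕ => ∑ r ∈ Finset.range (2 * R + 2), (-1 : ℝ) ^ r / r ! * y ^ r) atTop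
      (𝓝 (Real.exp (-y))) := by
  have hsum := (NormedSpace.expSeries_div_hasSum_exp (-y)).tendsto_sum_nat
  rw [← Real.exp_eq_exp_ℝ] at hsum
  have heven : Tendsto (fun R : ℕ => 2 * R + 2) atTop atTop :=
    tendsto_atTop_mono (fun R => by simp only [id]; lia) tendsto_id
  refine (hsum.comp heven).congr fun R => Finset.sum_congr rfl fun r _ => ?_
  rw [neg_pow, div_mul_eq_mul_div]

variable {ι : Type*} {l : Filter ι}

lemma ofReal_le_liminf_of_tendsto {g : ι → ℝ} {G : ℕ → ι → ℝ} {u : ℕ → ℝ} {v : ℝ}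
    (hG : ∀ R, ∀ᶠ i in l, G R i ≤ g i) (hGu : ∀ R, Tendsto (G R) l (𝓝 (u R)))
    (hu : Tendsto u atTop (𝓝 v)) :
    ENNReal.ofReal v ≤ liminf (fun i => ENNReal.ofReal (g i)) l := by
  refine le_of_forall_lt fun z hz => ?_
  obtain ⟨y, hzy, hyv⟩ := exists_between ((ENNReal.lt_ofReal_iff_toReal_lt hz.ne_top).1 hz)
  obtain ⟨R, hR⟩ := (hu.eventually (lt_mem_nhds hyv)).exists
  refine ((ENNReal.lt_ofReal_iff_toReal_lt hz.ne_top).2 hzy).trans_le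
    (le_liminf_of_le (by isBoundedDefault) ?_)
  filter_upwards [(hGu R).eventually (lt_mem_nhds hR), hG R] with i hlt hle
  exact ENNReal.ofReal_le_ofReal (hlt.le.trans hle)

lemma natCast_mul_measure_eq {Ω : Type*} [MeasurableSpace Ω] (μ : Measure Ω) [IsFiniteMeasure μ]
    (N : ℕ) (S : Set Ω) : (N : ℝ≥0∞) * μ S = ENNReal.ofReal (N * μ.real S) := by
  rw [ENNReal.ofReal_mul (Nat.cast_nonneg N), ENNReal.ofReal_natCast, ofReal_measureReal]

/-- The value of the normalized total when `T = t`. -/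
noncomputable def normalizedTime (m n t : ℕ) : ℝ :=
  ((t : ℝ) - n * Real.log n - ((m : ℝ) - 1) * n * Real.log (Real.log n)) / n

variable {n s k : ι → ℕ} {m : ℕ} {x : ℝ}

lemma tendsto_sub_of_normalizedTime (hm : 1 ≤ m) (hn : Tendsto n l atTop)
    (hs : Tendsto (fun i => normalizedTime m (n i) (s i)) l (𝓝 x)) :
    Tendsto (fun i => ((s i / n i : ℝ≥0) : ℝ) -
      (Real.log (n i) + (m - 1 : ℕ) * Real.log (Real.log (n i)))) l (𝓝 x) := by
  refine hs.congr' ?_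
  filter_upwards [eventually_pos_and_log_pos hn] with i ⟨hni, _⟩
  rw [normalizedTime, Nat.cast_sub hm]
  push_cast
  field_simp
  ring

lemma tendsto_div_div_log_of_normalizedTime (hm : 1 ≤ m) (hn : Tendsto n l atTop)
    (hs : Tendsto (fun i => normalizedTime m (n i) (s i)) l (𝓝 x)) :
    Tendsto (fun i => (s i : ℝ) / n i / Real.log (n i)) l (𝓝 1) := by
  simpa using tendsto_div_of_tendsto_sub (tendsto_log_natCast hn)
    (tendsto_sub_of_normalizedTime hm hn hs)

lemma tendsto_natCast_mul_poissonMeasure_real_singleton_pred (hm : 1 ≤ m) (hn : Tendsto n l atTop)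
    (hs : Tendsto (fun i => normalizedTime m (n i) (s i)) l (𝓝 x)) :
    Tendsto (fun i => n i * (poissonMeasure (s i / n i)).real {m - 1}) l
      (𝓝 (Real.exp (-x) / (m - 1)!)) := by
  have h := tendsto_exp_mul_poissonMeasure_real_singleton (tendsto_log_natCast hn)
    (tendsto_sub_of_normalizedTime hm hn hs) le_rfl
  rw [if_pos rfl] at h
  refine h.congr' ?_
  filter_upwards [eventually_pos_and_log_pos hn] with i ⟨hni, _⟩
  rw [Real.exp_log hni]

lemma tendsto_natCast_mul_poissonMeasure_real_range (hm : 1 ≤ m) (hn : Tendsto n l atTop)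
    (hs : Tendsto (fun i => normalizedTime m (n i) (s i)) l (𝓝 x)) :
    Tendsto (fun i => n i * (poissonMeasure (s i / n i)).real (Finset.range m)) l
      (𝓝 (Real.exp (-x) / (m - 1)!)) := by
  have h := tendsto_exp_mul_poissonMeasure_real_range (tendsto_log_natCast hn)
    (tendsto_sub_of_normalizedTime hm hn hs)
  rw [Nat.sub_add_cancel hm] at h
  refine h.congr' ?_
  filter_upwards [eventually_pos_and_log_pos hn] with i ⟨hni, _⟩
  rw [Real.exp_log hni]

lemma eventually_lt_of_tendsto_div_log {e : ℝ} (he : 0 < e) (hn : Tendsto n l atTop)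
    (hk : Tendsto (fun i => (k i : ℝ) / Real.log (n i)) l (𝓝 e)) (m : ℕ) :
    ∀ᶠ i in l, m < k i := by
  filter_upwards [(tendsto_atTop_of_tendsto_div (tendsto_log_natCast hn) he hk).eventually_gt_atTop
    (m : ℝ)] with i hi
  exact_mod_cast hi

variable {Ω : ι → Type*} [∀ i, MeasurableSpace (Ω i)] {P : ∀ i, Measure (Ω i)}
  {C : ∀ i, ℕ → Ω i → Fin (n i)} {e a q y : ℝ} {c j : ℕ}

lemma tendsto_integral_tupleSets (hC : ∀ i, IsCouponSequence (C i) (P i)) (hn : Tendsto n l atTop)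
    (hs : Tendsto (fun i => (s i : ℝ) / n i / Real.log (n i)) l (𝓝 1))
    (hk : Tendsto (fun i => (k i : ℝ) / Real.log (n i)) l (𝓝 e)) (hc : ∀ᶠ i in l, c ≤ k i)
    {D : ι → Finset ℕ} (hD : ∀ᶠ i in l, ∀ b ∈ D i, b ≤ k i) {w : ι → ℝ} (hw : ∀ i, 0 ≤ w i)
    (ha : Tendsto (fun i => n i * (poissonMeasure (s i / n i)).real {c}) l (𝓝 a))
    (hq : ∀ _ : Fin j, Tendsto (fun i => n i * (poissonMeasure (s i / n i)).real {k i}) l (𝓝 q))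
    (hy : Tendsto (fun i => n i * (w i * (poissonMeasure (s i / n i)).real (D i))) l (𝓝 y))
    (r : ℕ) :
    Tendsto (fun i => w i ^ r *
      ∫ ω, (tupleCount (tupleSets c (k i) j r (D i)) (counts (C i) (s i) ω) : ℝ) ∂P i) l
      (𝓝 (a * q ^ j * y ^ r)) := by
  have h := tendsto_integral_tupleCount hC hn hs hk (B := fun i => tupleSets c (k i) j r (D i))
    (w := fun i => Sum.elim (fun _ => 1) fun _ => w i)
    (v := Sum.elim (Sum.elim (fun _ => a) fun _ => q) fun _ => y) ?_ ?_ ?_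
  · simpa [Fintype.prod_sum_type] using h
  · filter_upwards [hc, hD] with i hci hDi
    rintro ((_ | _) | _) b hb
    · exact (Finset.mem_singleton.1 hb).trans_le hci
    · exact (Finset.mem_singleton.1 hb).le
    · exact hDi b hb
  · rintro i (_ | _)
    · exact zero_le_one
    · exact hw i
  · rintro ((_ | b) | _)
    · simpa [tupleSets] using ha
    · simpa [tupleSets] using hq b
    · simpa [tupleSets] using hy

theorem le_liminf_kTons_eq (hm : 1 ≤ m) (hC : ∀ i, IsCouponSequence (C i) (P i))
    (hn : Tendsto n l atTop) (hs : Tendsto (fun i => normalizedTime m (n i) (s i)) l (𝓝 x))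
    (he : 0 < e) (hk : Tendsto (fun i => (k i : ℝ) / Real.log (n i)) l (𝓝 e))
    (hq : Tendsto (fun i => n i * (poissonMeasure (s i / n i)).real {k i}) l (𝓝 q)) (j : ℕ) :
    ENNReal.ofReal (Real.exp (-x) / (m - 1)! * (q ^ j / j !) *
        Real.exp (-(Real.exp (-x) / (m - 1)! + q))) ≤
      liminf (fun i => (n i : ℝ≥0∞) * P i {ω | total m (fun t => C i t ω) = s i + 1 ∧
        kTons m (k i) (fun t => C i t ω) = j}) l := by
  have (i : ι) := (hC i).isProbabilityMeasure
  set a : ℝ := Real.exp (-x) / (m - 1)!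
  have hmk := eventually_lt_of_tendsto_div_log he hn hk m
  have ha : Tendsto _ l (𝓝 a) := tendsto_natCast_mul_poissonMeasure_real_singleton_pred hm hn hs
  have hunion : Tendsto (fun i => n i * (1 *
      (poissonMeasure (s i / n i)).real (insert (k i) (Finset.range m) : Finset ℕ))) l
      (𝓝 (a + q)) := by
    refine (add_comm q a ▸
      hq.add (tendsto_natCast_mul_poissonMeasure_real_range hm hn hs)).congr' ?_
    filter_upwards [hmk] with i hi
    rw [Finset.coe_insert, Set.insert_eq, measureReal_union (by simpa using hi.le)
      (Finset.measurableSet _), one_mul, mul_add]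
  have hmoment := tendsto_integral_tupleSets (c := m - 1) (j := j) hC hn
    (tendsto_div_div_log_of_normalizedTime hm hn hs) hk (hmk.mono fun i hi => by lia)
    (hmk.mono fun i hi b hb => by
      simp only [Finset.mem_insert, Finset.mem_range] at hb
      lia) (fun _ => zero_le_one)
    ha (fun _ => hq) hunion
  simp only [one_pow, one_mul] at hmoment
  simp only [natCast_mul_measure_eq]
  refine ofReal_le_liminf_of_tendsto
    (fun R => hmk.mono fun i hi => (hC i).sum_integral_tupleCount_le hm hi (s i) j R)
    (fun R => tendsto_finsetSum _ fun r _ => (hmoment r).const_mul _) ?_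
  refine ((tendsto_sum_alternating (a + q)).const_mul (a * (q ^ j / j !))).congr fun R => ?_
  rw [Finset.mul_sum]
  refine Finset.sum_congr rfl fun r _ => ?_
  push_cast
  field_simp

lemma tendsto_normalized_variance (hC : ∀ i, IsCouponSequence (C i) (P i))
    (hn : Tendsto n l atTop) (hs : Tendsto (fun i => (s i : ℝ) / n i / Real.log (n i)) l (𝓝 1))
    (hk : Tendsto (fun i => (k i : ℝ) / Real.log (n i)) l (𝓝 e)) (hc : ∀ᶠ i in l, c ≤ k i)
    (ha : Tendsto (fun i => n i * (poissonMeasure (s i / n i)).real {c}) l (𝓝 a)) {Λ : ι → ℝ}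
    (hΛ : Λ = fun i => n i * (poissonMeasure (s i / n i)).real {k i})
    (hΛtop : Tendsto Λ l atTop) :
    Tendsto (fun i =>
      1 / Λ i ^ 2 *
          ∫ ω, (tupleCount (tupleSets c (k i) 0 2 {k i}) (counts (C i) (s i) ω) : ℝ) ∂P i +
        (1 / Λ i ^ 2 - 2 / Λ i) *
          ∫ ω, (tupleCount (tupleSets c (k i) 0 1 {k i}) (counts (C i) (s i) ω) : ℝ) ∂P i +
        ∫ ω, (tupleCount (tupleSets c (k i) 0 0 {k i}) (counts (C i) (s i) ω) : ℝ) ∂P i) l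
      (𝓝 0) := by
  have hmoment := tendsto_integral_tupleSets (q := 0) (y := 1) (j := 0) (w := fun i => (Λ i)⁻¹)
    (D := fun i => {k i}) hC hn hs hk hc (by simp)
    (fun i => inv_nonneg.2 (by rw [hΛ]; positivity)) ha Fin.elim0 (by
      refine tendsto_const_nhds.congr' ?_
      filter_upwards [hΛtop.eventually_gt_atTop 0] with i hi
      rw [mul_left_comm, Finset.coe_singleton, ← congr_fun hΛ i, inv_mul_cancel₀ hi.ne'])
  have h := ((hmoment 2).add ((hΛtop.inv_tendsto_atTop.sub_const 2).mul (hmoment 1))).add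
    (hmoment 0)
  have hlim : a * 0 ^ 0 * 1 ^ 2 + (0 - 2) * (a * 0 ^ 0 * 1 ^ 1) + a * 0 ^ 0 * 1 ^ 0 = 0 := by
    ring
  rw [hlim] at h
  refine h.congr fun i => ?_
  simp only [Pi.inv_apply]
  ring

theorem le_liminf_kTons_ne_zero (hm : 1 ≤ m) (hC : ∀ i, IsCouponSequence (C i) (P i))
    (hn : Tendsto n l atTop) (hs : Tendsto (fun i => normalizedTime m (n i) (s i)) l (𝓝 x))
    (he : 0 < e) (hk : Tendsto (fun i => (k i : ℝ) / Real.log (n i)) l (𝓝 e))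
    (hq : Tendsto (fun i => n i * (poissonMeasure (s i / n i)).real {k i}) l atTop) :
    ENNReal.ofReal (Real.exp (-x) / (m - 1)! * Real.exp (-(Real.exp (-x) / (m - 1)!))) ≤
      liminf (fun i => (n i : ℝ≥0∞) * P i {ω | total m (fun t => C i t ω) = s i + 1 ∧
        kTons m (k i) (fun t => C i t ω) ≠ 0}) l := by
  have (i : ι) := (hC i).isProbabilityMeasure
  set a : ℝ := Real.exp (-x) / (m - 1)!
  have hmk := eventually_lt_of_tendsto_div_log he hn hk m
  have hck : ∀ᶠ i in l, m - 1 ≤ k i := hmk.mono fun i hi => by lia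
  have hsn := tendsto_div_div_log_of_normalizedTime hm hn hs
  have ha := tendsto_natCast_mul_poissonMeasure_real_singleton_pred hm hn hs
  have hmoment := tendsto_integral_tupleSets (q := 0) (j := 0) (w := fun _ => 1)
    (D := fun _ => Finset.range m) hC hn hsn hk hck
    (hmk.mono fun i hi b hb => ((Finset.mem_range.1 hb).trans hi).le) (fun _ => zero_le_one) ha
    Fin.elim0 (by simpa using tendsto_natCast_mul_poissonMeasure_real_range hm hn hs)
  simp only [one_pow, one_mul, pow_zero, mul_one] at hmoment
  simp only [natCast_mul_measure_eq]
  refine ofReal_le_liminf_of_tendsto (fun R => ?_)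
    (fun R => (tendsto_finsetSum (Finset.range (2 * R + 2)) fun r _ =>
      (hmoment r).const_mul ((-1 : ℝ) ^ r / r !)).sub
        (tendsto_normalized_variance hC hn hsn hk hck ha rfl hq)) ?_
  · filter_upwards [hmk, hq.eventually_gt_atTop 0] with i hi hΛ
    exact (hC i).sum_integral_tupleCount_sub_le hm hi hΛ (s i) R
  · refine ((tendsto_sum_alternating a).const_mul a).congr fun R => ?_
    rw [Finset.mul_sum, sub_zero]
    exact Finset.sum_congr rfl fun r _ => mul_left_comm _ _ _

end LocalLimit

section Measurability

lemma measurable_sInf_nat {Ω : Type*} [MeasurableSpace Ω] {A : ℕ → Set Ω}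
    (hA : ∀ t, MeasurableSet (A t)) : Measurable fun ω => sInf {t | ω ∈ A t} := by
  refine measurable_of_Iic fun t => ?_
  have hIic : (fun ω => sInf {t | ω ∈ A t}) ⁻¹' Set.Iic t = (⋃ s ≤ t, A s) ∪ (⋃ s, A s)ᶜ := by
    ext ω
    simp only [Set.mem_preimage, Set.mem_Iic, Set.mem_union, Set.mem_iUnion, exists_prop,
      Set.mem_compl_iff]
    by_cases h : ∃ s, ω ∈ A s
    · simp only [h, not_true_eq_false, or_false]
      exact ⟨fun hle => ⟨_, hle, Nat.sInf_mem h⟩, fun ⟨s, hst, hs⟩ => (Nat.sInf_le hs).trans hst⟩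
    · have hempty : {t | ω ∈ A t} = ∅ := Set.eq_empty_of_forall_notMem fun s hs => h ⟨s, hs⟩
      simp [h, hempty]
  rw [hIic]
  exact (MeasurableSet.iUnion fun s => MeasurableSet.iUnion fun _ => hA s).union
    (MeasurableSet.iUnion hA).compl

variable {Ω : Type*} [MeasurableSpace Ω] {P : Measure Ω} {n : ℕ} {C : ℕ → Ω → Fin n}

lemma IsCouponSequence.measurable_total (hC : IsCouponSequence C P) (m : ℕ) :
    Measurable fun ω => total m fun t => C t ω :=
  measurable_sInf_nat (A := fun t => {ω | ∀ i, m ≤ counts C t ω i}) fun t =>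
    hC.measurableSet_counts t {N | ∀ i, m ≤ N i}

lemma IsCouponSequence.measurable_kTons (hC : IsCouponSequence C P) (m k : ℕ) :
    Measurable fun ω => kTons m k fun t => C t ω := by
  have hcount : Measurable fun p : ℕ × Ω => numWith (counts C p.1 p.2) {k} :=
    measurable_from_prod_countable_right fun t =>
      (Measurable.of_discrete (f := fun N : Fin n → ℕ => numWith N {k})).comp
        (hC.measurable_counts t)
  convert hcount.comp ((hC.measurable_total m).prodMk measurable_id) using 2 with ω
  simp [kTons, numWith, counts, Fintype.card_subtype]

lemma IsCouponSequence.measurable_normalizedTotal (hC : IsCouponSequence C P) (m : ℕ) :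
    Measurable fun ω => normalizedTotal m fun t => C t ω :=
  (Measurable.of_discrete (f := normalizedTime m n)).comp (hC.measurable_total m)

end Measurability

section Fatou

lemma lintegral_mul_measure_singleton_floor (ν : Measure ℤ) (a : ℝ) {c : ℝ} (hc : 0 < c) :
    ∫⁻ x : ℝ, ENNReal.ofReal c * ν {⌊a + c * x⌋} = ν Set.univ := by
  have hfloor : Measurable fun x : ℝ => ⌊a + c * x⌋ := Int.measurable_floor.comp (by fun_prop)
  have hvolume (z : ℤ) :
      (volume.map fun x : ℝ => ⌊a + c * x⌋) {z} = (ENNReal.ofReal c)⁻¹ := by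
    have hIco : (fun x : ℝ => ⌊a + c * x⌋) ⁻¹' {z} = Set.Ico ((z - a) / c) ((z + 1 - a) / c) := by
      ext x
      simp only [Set.mem_preimage, Set.mem_singleton_iff, Int.floor_eq_iff, Set.mem_Ico,
        div_le_iff₀ hc, lt_div_iff₀ hc, mul_comm x]
      constructor <;> rintro ⟨_, _⟩ <;> constructor <;> linarith
    rw [Measure.map_apply hfloor (measurableSet_singleton z), hIco, Real.volume_Ico,
      ← ENNReal.ofReal_inv_of_pos hc]
    congr 1
    field_simp
    ring
  calc ∫⁻ x : ℝ, ENNReal.ofReal c * ν {⌊a + c * x⌋}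
      = ∫⁻ z : ℤ, ENNReal.ofReal c * ν {z} ∂volume.map fun x : ℝ => ⌊a + c * x⌋ :=
        (lintegral_map (f := fun z : ℤ => ENNReal.ofReal c * ν {z}) Measurable.of_discrete
          hfloor).symm
    _ = ∑' z : ℤ, ν {z} := by
        rw [lintegral_countable']
        refine tsum_congr fun z => ?_
        rw [hvolume, mul_right_comm,
          ENNReal.mul_inv_cancel (ENNReal.ofReal_pos.2 hc).ne' ENNReal.ofReal_ne_top, one_mul]
    _ = ν Set.univ := by
        simpa using (lintegral_countable' (μ := ν) fun _ => 1).symm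

variable {ι : Type*} {l : Filter ι} {Ω : ι → Type*} [∀ i, MeasurableSpace (Ω i)]
  {P : ∀ i, Measure (Ω i)}

lemma lintegral_le_liminf_measure [l.IsCountablyGenerated] {T : ∀ i, Ω i → ℤ}
    (hT : ∀ i, Measurable (T i)) (E : ∀ i, Set (Ω i)) (a : ι → ℝ) {c : ι → ℝ}
    (hc : ∀ i, 0 < c i) {f : ℝ → ℝ≥0∞}
    (hf : ∀ x, f x ≤
      liminf (fun i => ENNReal.ofReal (c i) * P i (T i ⁻¹' {⌊a i + c i * x⌋} ∩ E i)) l) :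
    ∫⁻ x, f x ≤ liminf (fun i => P i (E i)) l := by
  let ν (i : ι) : Measure ℤ := ((P i).restrict (E i)).map (T i)
  have hν (i : ι) (z : ℤ) : P i (T i ⁻¹' {z} ∩ E i) = ν i {z} := by
    rw [Measure.map_apply (hT i) (measurableSet_singleton z),
      Measure.restrict_apply (hT i (measurableSet_singleton z))]
  have hmeas (i : ι) : Measurable fun x : ℝ => ENNReal.ofReal (c i) * ν i {⌊a i + c i * x⌋} :=
    (Measurable.of_discrete (f := fun z : ℤ => ENNReal.ofReal (c i) * ν i {z})).comp
      (Int.measurable_floor.comp (by fun_prop))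
  simp only [hν] at hf
  refine (lintegral_mono hf).trans ((lintegral_liminf_le hmeas).trans_eq ?_)
  congr! 2 with i
  rw [lintegral_mul_measure_singleton_floor _ _ (hc i), Measure.map_apply (hT i) .univ,
    Set.preimage_univ, Measure.restrict_apply_univ]

lemma tsum_liminf_le_liminf_measure {β : Type*} [Countable β] [MeasurableSpace β]
    [MeasurableSingletonClass β] (c : ι → ℝ≥0∞) {E : ∀ i, Set (Ω i)}
    {Y : ∀ i, Ω i → β} (hY : ∀ i, Measurable (Y i)) [l.IsCountablyGenerated] :
    ∑' b, liminf (fun i => c i * P i (Y i ⁻¹' {b} ∩ E i)) l ≤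
      liminf (fun i => c i * P i (E i)) l := by
  have hsum (i : ι) : ∑' b, c i * P i (Y i ⁻¹' {b} ∩ E i) = c i * P i (E i) := by
    rw [ENNReal.tsum_mul_left, ← Measure.restrict_apply_univ (E i), ← Set.preimage_univ (f := Y i),
      ← Measure.map_apply (hY i) .univ, ← lintegral_one, lintegral_countable']
    refine congr_arg _ (tsum_congr fun b => ?_)
    rw [one_mul, Measure.map_apply (hY i) (measurableSet_singleton b),
      Measure.restrict_apply (hY i (measurableSet_singleton b))]
  simp only [← hsum, ← lintegral_count]
  exact lintegral_liminf_le fun i => Measurable.of_discrete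

lemma tendsto_measure_compl_of_one_le_liminf [∀ i, IsProbabilityMeasure (P i)]
    {E : ∀ i, Set (Ω i)} (hE : ∀ i, MeasurableSet (E i))
    (h : 1 ≤ liminf (fun i => P i (E i)) l) : Tendsto (fun i => P i (E i)ᶜ) l (𝓝 0) := by
  have hone : Tendsto (fun i => P i (E i)) l (𝓝 1) := by
    rcases l.eq_or_neBot with rfl | _
    · exact tendsto_bot
    · exact tendsto_of_le_liminf_of_limsup_le h
        (limsup_le_of_le (by isBoundedDefault) (Eventually.of_forall fun i => prob_le_one))
  simpa [prob_compl_eq_one_sub (hE _)] using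
    ENNReal.Tendsto.sub (tendsto_const_nhds (x := (1 : ℝ≥0∞))) hone (Or.inl ENNReal.one_ne_top)

end Fatou

section Gumbel

lemma gumbel_eq_withDensity {c : ℝ} (hc : 0 < c) :
    gumbel (-Real.log c) 1 one_pos = volume.withDensity fun x =>
      ENNReal.ofReal (Real.exp (-x) / c * Real.exp (-(Real.exp (-x) / c))) := by
  have hcdf (x : ℝ) : gumbelCDF (-Real.log c) 1 one_pos x = Real.exp (-(Real.exp (-x) / c)) := by
    change Real.exp (-Real.exp (-(x - -Real.log c) / 1)) = _
    rw [div_one, sub_neg_eq_add, neg_add, ← sub_eq_add_neg, Real.exp_sub, Real.exp_log hc]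
  have hderiv (x : ℝ) : HasDerivAt (fun x => Real.exp (-(Real.exp (-x) / c)))
      (Real.exp (-x) / c * Real.exp (-(Real.exp (-x) / c))) x := by
    have hneg : HasDerivAt (fun x : ℝ => -(Real.exp (-x) / c)) (Real.exp (-x) / c) x :=
      ((hasDerivAt_neg x).exp.div_const c).neg.congr_deriv (by ring)
    exact hneg.exp.congr_deriv (mul_comm _ _)
  have hcont : Continuous fun x : ℝ => Real.exp (-x) / c * Real.exp (-(Real.exp (-x) / c)) := by
    fun_prop
  refine Measure.ext_of_Ioc _ _ fun a b hab => ?_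
  rw [gumbel, StieltjesFunction.measure_Ioc, hcdf, hcdf, withDensity_apply _ measurableSet_Ioc,
    ← ofReal_integral_eq_lintegral_ofReal hcont.integrableOn_Ioc
      (Eventually.of_forall fun x => by positivity),
    ← intervalIntegral.integral_of_le hab.le,
    intervalIntegral.integral_eq_sub_of_hasDerivAt (fun x _ => hderiv x)
      (hcont.intervalIntegrable _ _)]

lemma lintegral_gumbel_density {c : ℝ} (hc : 0 < c) :
    ∫⁻ x : ℝ, ENNReal.ofReal (Real.exp (-x) / c * Real.exp (-(Real.exp (-x) / c))) = 1 := by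
  have h := measure_univ (μ := gumbel (-Real.log c) 1 one_pos)
  rwa [gumbel_eq_withDensity hc, withDensity_apply _ .univ, setLIntegral_univ] at h

lemma limitLaw_apply (m : ℕ) (d : ℝ) {G : Set (ℝ × ℕ)} (hG : MeasurableSet G) :
    limitLaw m d G = ∫⁻ x, ENNReal.ofReal (Real.exp (-x) / (m - 1)! *
      Real.exp (-(Real.exp (-x) / (m - 1)!))) * poissonMeasure (rate d x) (Prod.mk x ⁻¹' G) := by
  rw [limitLaw, Measure.compProd_apply hG,
    gumbel_eq_withDensity (Nat.cast_pos.2 (Nat.factorial_pos _)),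
    lintegral_withDensity_eq_lintegral_mul₀ (by fun_prop)
      (Kernel.measurable_kernel_prodMk_left hG).aemeasurable]
  rfl

end Gumbel

section LimitTheorems

open Asymptotics

variable {ι : Type*} {l : Filter ι} {n s k : ι → ℕ} {δ : ι → ℝ} {m : ℕ} {x : ℝ}

lemma tendsto_normalizedTime_floor (hn : Tendsto n l atTop) {u : ι → ℝ} (hu : ∀ᶠ i in l, 0 ≤ u i)
    (hux : ∀ i, u i = Real.log (n i) + ((m : ℝ) - 1) * Real.log (Real.log (n i)) + x) :
    Tendsto (fun i => normalizedTime m (n i) ⌊n i * u i⌋₊) l (𝓝 x) := by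
  have hn' : Tendsto (fun i => (n i : ℝ)) l atTop := tendsto_natCast_atTop_atTop.comp hn
  have hlow : Tendsto (fun i => x - 1 / (n i : ℝ)) l (𝓝 x) := by
    simpa using hn'.inv_tendsto_atTop.const_sub x
  have heq {i : ι} (hi : 0 < (n i : ℝ)) :
      normalizedTime m (n i) ⌊n i * u i⌋₊ = x + (⌊n i * u i⌋₊ - n i * u i) / n i := by
    rw [normalizedTime, hux]
    field_simp
    ring
  refine tendsto_of_tendsto_of_tendsto_of_le_of_le' hlow tendsto_const_nhds ?_ ?_
  · filter_upwards [hn'.eventually_gt_atTop 0] with i hi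
    rw [heq hi, sub_eq_add_neg, ← neg_div]
    gcongr
    linarith [Nat.lt_floor_add_one (n i * u i)]
  · filter_upwards [hn'.eventually_gt_atTop 0, hu] with i hi hui
    rw [heq hi, add_le_iff_nonpos_right]
    exact div_nonpos_of_nonpos_of_nonneg (sub_nonpos.2 (Nat.floor_le (by positivity))) hi.le

lemma tendsto_normalizedTime_add_one (hn : Tendsto n l atTop)
    (hs : Tendsto (fun i => normalizedTime m (n i) (s i)) l (𝓝 x)) :
    Tendsto (fun i => normalizedTime m (n i) (s i + 1)) l (𝓝 x) := by
  have hinv := (tendsto_natCast_atTop_atTop (R := ℝ).comp hn).inv_tendsto_atTop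
  refine (by simpa using hs.add hinv : Tendsto _ l (𝓝 x)).congr fun i => ?_
  simp only [normalizedTime, Nat.cast_add, Nat.cast_one]
  ring

lemma eventually_log_add_nonneg (hm : 1 ≤ m) (hn : Tendsto n l atTop) (x : ℝ) :
    ∀ᶠ i in l, 0 ≤ Real.log (n i) + ((m : ℝ) - 1) * Real.log (Real.log (n i)) + x := by
  have hm' : (0 : ℝ) ≤ (m : ℝ) - 1 := sub_nonneg.2 (by exact_mod_cast hm)
  filter_upwards [(tendsto_log_natCast hn).eventually_ge_atTop 1,
    (tendsto_log_natCast hn).eventually_ge_atTop (-x)] with i hone hx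
  linarith [mul_nonneg hm' (Real.log_nonneg hone)]

lemma tendsto_div_log_of_eq_centre (hn : Tendsto n l atTop)
    (hk : ∀ᶠ i in l, (k i : ℝ) = centre m (n i) + δ i)
    (hδ : δ =o[l] fun i => Real.log (Real.log (n i))) :
    Tendsto (fun i => (k i : ℝ) / Real.log (n i)) l (𝓝 (Real.exp 1)) :=
  tendsto_div_exp_one (tendsto_log_natCast hn) hk hδ

lemma tendsto_natCast_mul_poissonMeasure_real_singleton_mul_exp (hm : 1 ≤ m)
    (hn : Tendsto n l atTop) (hk : ∀ᶠ i in l, (k i : ℝ) = centre m (n i) + δ i)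
    (hδ : δ =o[l] fun i => Real.log (Real.log (n i)))
    (hs : Tendsto (fun i => normalizedTime m (n i) (s i)) l (𝓝 x)) :
    Tendsto (fun i => n i * (poissonMeasure (s i / n i)).real {k i} * Real.exp (δ i)) l
      (𝓝 (Real.exp ((Real.exp 1 - 1) * x) / √(2 * Real.pi * Real.exp 1))) := by
  refine (tendsto_exp_mul_poissonMeasure_real_singleton_mul_exp (tendsto_log_natCast hn)
    (tendsto_sub_of_normalizedTime hm hn hs)
    (by simpa only [centre, Nat.cast_pred hm] using hk) hδ).congr' ?_
  filter_upwards [eventually_pos_and_log_pos hn] with i ⟨hni, _⟩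
  rw [Real.exp_log hni]

lemma isLittleO_log_log_of_tendsto (hn : Tendsto n l atTop) {d : ℝ} (hδ : Tendsto δ l (𝓝 d)) :
    δ =o[l] fun i => Real.log (Real.log (n i)) :=
  isLittleO_of_tendsto_of_atTop hδ (Real.tendsto_log_atTop.comp (tendsto_log_natCast hn))

variable {Ω : ι → Type*} [∀ i, MeasurableSpace (Ω i)] {P : ∀ i, Measure (Ω i)}
  {C : ∀ i, ℕ → Ω i → Fin (n i)}

lemma density_mul_poissonMeasure_singleton_le_liminf (hm : 1 ≤ m)
    (hC : ∀ i, IsCouponSequence (C i) (P i)) (hn : Tendsto n l atTop)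
    (hk : ∀ᶠ i in l, (k i : ℝ) = centre m (n i) + δ i) {d : ℝ} (hδ : Tendsto δ l (𝓝 d))
    (hs : Tendsto (fun i => normalizedTime m (n i) (s i)) l (𝓝 x)) (j : ℕ) :
    ENNReal.ofReal (Real.exp (-x) / (m - 1)! * Real.exp (-(Real.exp (-x) / (m - 1)!))) *
        poissonMeasure (rate d x) {j} ≤
      liminf (fun i => (n i : ℝ≥0∞) * P i {ω | total m (fun t => C i t ω) = s i + 1 ∧
        kTons m (k i) (fun t => C i t ω) = j}) l := by
  have hδlog := isLittleO_log_log_of_tendsto hn hδ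
  have hq : Tendsto (fun i => n i * (poissonMeasure (s i / n i)).real {k i}) l
      (𝓝 (rate d x)) := by
    have h := (tendsto_natCast_mul_poissonMeasure_real_singleton_mul_exp hm hn hk hδlog hs).mul
      ((Real.continuous_exp.tendsto _).comp hδ.neg)
    rw [div_mul_eq_mul_div, ← Real.exp_add, ← sub_eq_add_neg] at h
    rw [rate, Real.coe_toNNReal _ (by positivity)]
    simpa [mul_assoc, ← Real.exp_add] using h
  refine le_trans (le_of_eq ?_) (le_liminf_kTons_eq hm hC hn hs (Real.exp_pos 1)
    (tendsto_div_log_of_eq_centre hn hk hδlog) hq j)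
  rw [poissonMeasure_singleton, ← ENNReal.ofReal_mul (by positivity), neg_add, Real.exp_add]
  congr 1
  ring

variable [l.IsCountablyGenerated]

theorem lintegral_le_liminf_of_le_liminf_total (hm : 1 ≤ m)
    (hC : ∀ i, IsCouponSequence (C i) (P i)) (hn : Tendsto n l atTop) (E : ∀ i, Set (Ω i))
    {f : ℝ → ℝ≥0∞}
    (hf : ∀ x (s : ι → ℕ), Tendsto (fun i => normalizedTime m (n i) (s i)) l (𝓝 x) →
      f x ≤ liminf (fun i => (n i : ℝ≥0∞) *
        P i ({ω | total m (fun t => C i t ω) = s i + 1} ∩ E i)) l) :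
    ∫⁻ x, f x ≤ liminf (fun i => P i (E i)) l := by
  let T (i : ι) (ω : Ω i) : ℤ := total m (fun t => C i t ω) - 1
  have hT (i : ι) : Measurable (T i) :=
    (Measurable.of_discrete (f := fun t : ℕ => (t : ℤ) - 1)).comp ((hC i).measurable_total m)
  let a (i : ι) : ℝ := n i * (Real.log (n i) + ((m : ℝ) - 1) * Real.log (Real.log (n i)))
  refine lintegral_le_liminf_measure hT E a (c := fun i => n i)
    (fun i => Nat.cast_pos.2 (hC i).pos) fun x => ?_
  have hnonneg := eventually_log_add_nonneg hm hn x
  refine (hf x _ (tendsto_normalizedTime_floor hn hnonneg fun i => rfl)).trans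
    (liminf_le_liminf ?_)
  filter_upwards [hnonneg] with i hi
  rw [ENNReal.ofReal_natCast]
  gcongr
  intro ω hω
  have hω' : total m (fun t => C i t ω) = _ + 1 := hω
  simp only [T, a, Set.mem_preimage, Set.mem_singleton_iff, hω', ← mul_add]
  rw [← Int.natCast_floor_eq_floor (by positivity)]
  simp

theorem tendsto_measure_kTons_ne_zero (hm : 1 ≤ m) (hC : ∀ i, IsCouponSequence (C i) (P i))
    (hn : Tendsto n l atTop) (hk : ∀ᶠ i in l, (k i : ℝ) = centre m (n i) + δ i)
    (hδ : δ =o[l] fun i => Real.log (Real.log (n i))) (hδtop : Tendsto δ l atTop) :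
    Tendsto (fun i => P i {ω | kTons m (k i) (fun t => C i t ω) ≠ 0}) l (𝓝 0) := by
  have (i : ι) := (hC i).isProbabilityMeasure
  refine tendsto_measure_compl_of_one_le_liminf
    (fun i => (hC i).measurable_kTons m (k i) (measurableSet_singleton 0)) ?_
  rw [← lintegral_gumbel_density (Nat.cast_pos.2 (m - 1).factorial_pos)]
  refine lintegral_le_liminf_of_le_liminf_total hm hC hn _ fun x s hs => ?_
  have hq : Tendsto (fun i => n i * (poissonMeasure (s i / n i)).real {k i}) l (𝓝 0) := by
    have h := (tendsto_natCast_mul_poissonMeasure_real_singleton_mul_exp hm hn hk hδ hs).mul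
      (Real.tendsto_exp_neg_atTop_nhds_zero.comp hδtop)
    simpa [mul_assoc, ← Real.exp_add] using h
  have h := le_liminf_kTons_eq hm hC hn hs (Real.exp_pos 1)
    (tendsto_div_log_of_eq_centre hn hk hδ) hq 0
  simp only [add_zero, pow_zero, Nat.factorial_zero, Nat.cast_one, div_one, mul_one] at h
  exact h

theorem tendsto_measure_kTons_eq_zero (hm : 1 ≤ m) (hC : ∀ i, IsCouponSequence (C i) (P i))
    (hn : Tendsto n l atTop) (hk : ∀ᶠ i in l, (k i : ℝ) = centre m (n i) + δ i)
    (hδ : δ =o[l] fun i => Real.log (Real.log (n i))) (hδbot : Tendsto δ l atBot) :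
    Tendsto (fun i => P i {ω | kTons m (k i) (fun t => C i t ω) = 0}) l (𝓝 0) := by
  have (i : ι) := (hC i).isProbabilityMeasure
  suffices h : Tendsto (fun i => P i {ω | kTons m (k i) (fun t => C i t ω) ≠ 0}ᶜ) l (𝓝 0) by
    simpa [Set.compl_ofPred] using h
  refine tendsto_measure_compl_of_one_le_liminf
    (fun i => ((hC i).measurable_kTons m (k i) (measurableSet_singleton 0)).compl) ?_
  rw [← lintegral_gumbel_density (Nat.cast_pos.2 (m - 1).factorial_pos)]
  refine lintegral_le_liminf_of_le_liminf_total hm hC hn _ fun x s hs => ?_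
  have hq : Tendsto (fun i => n i * (poissonMeasure (s i / n i)).real {k i}) l atTop := by
    have h := (tendsto_natCast_mul_poissonMeasure_real_singleton_mul_exp hm hn hk hδ
      hs).pos_mul_atTop (by positivity)
      (Real.tendsto_exp_atTop.comp (tendsto_neg_atBot_atTop.comp hδbot))
    simpa [mul_assoc, ← Real.exp_add] using h
  exact le_liminf_kTons_ne_zero hm hC hn hs (Real.exp_pos 1)
    (tendsto_div_log_of_eq_centre hn hk hδ) hq

lemma density_mul_poissonMeasure_le_liminf (hm : 1 ≤ m)
    (hC : ∀ i, IsCouponSequence (C i) (P i)) (hn : Tendsto n l atTop)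
    (hk : ∀ᶠ i in l, (k i : ℝ) = centre m (n i) + δ i) {d : ℝ} (hδ : Tendsto δ l (𝓝 d))
    (hs : Tendsto (fun i => normalizedTime m (n i) (s i)) l (𝓝 x)) {G : Set (ℝ × ℕ)}
    (hG : IsOpen G) :
    ENNReal.ofReal (Real.exp (-x) / (m - 1)! * Real.exp (-(Real.exp (-x) / (m - 1)!))) *
        poissonMeasure (rate d x) (Prod.mk x ⁻¹' G) ≤
      liminf (fun i => (n i : ℝ≥0∞) * P i ({ω | total m (fun t => C i t ω) = s i + 1} ∩
        {ω | (normalizedTotal m (fun t => C i t ω), kTons m (k i) (fun t => C i t ω)) ∈ G})) l := by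
  refine le_trans ?_ (tsum_liminf_le_liminf_measure _ fun i => (hC i).measurable_kTons m (k i))
  rw [← lintegral_indicator_one (.of_discrete (s := Prod.mk x ⁻¹' G)), lintegral_countable',
    ← ENNReal.tsum_mul_left]
  refine ENNReal.tsum_le_tsum fun j => ?_
  by_cases hj : (x, j) ∈ G
  · rw [Set.indicator_of_mem (by exact hj), Pi.one_apply, one_mul]
    refine (density_mul_poissonMeasure_singleton_le_liminf hm hC hn hk hδ hs j).trans
      (liminf_le_liminf ?_)
    filter_upwards [((tendsto_normalizedTime_add_one hn hs).prodMk_nhds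
      (tendsto_const_nhds (x := j))).eventually (hG.mem_nhds hj)] with i hi
    gcongr
    rintro ω ⟨hT, hS⟩
    refine ⟨hS, hT, ?_⟩
    change (normalizedTime m (n i) (total m fun t => C i t ω), _) ∈ G
    rwa [hT, hS]
  · simp [hj]

theorem tendstoInDistribution_normalizedTotal_kTons [∀ i, IsProbabilityMeasure (P i)]
    (hm : 1 ≤ m) (hC : ∀ i, IsCouponSequence (C i) (P i)) (hn : Tendsto n l atTop)
    (hk : ∀ᶠ i in l, (k i : ℝ) = centre m (n i) + δ i) {d : ℝ} (hδ : Tendsto δ l (𝓝 d)) :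
    TendstoInDistribution
      (fun i ω => (normalizedTotal m (fun t => C i t ω), kTons m (k i) (fun t => C i t ω)))
      l (id : ℝ × ℕ → ℝ × ℕ) P (limitLaw m d) := by
  have hmeas (i : ι) : Measurable fun ω =>
      (normalizedTotal m (fun t => C i t ω), kTons m (k i) (fun t => C i t ω)) :=
    ((hC i).measurable_normalizedTotal m).prodMk ((hC i).measurable_kTons m (k i))
  refine ⟨fun i => (hmeas i).aemeasurable, aemeasurable_id,
    tendsto_of_forall_isOpen_le_liminf' fun G hG => ?_⟩
  simp only [ProbabilityMeasure.coe_mk, Measure.map_id, Measure.map_apply (hmeas _)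
    hG.measurableSet, limitLaw_apply m d hG.measurableSet]
  exact lintegral_le_liminf_of_le_liminf_total hm hC hn _ fun x s hs =>
    density_mul_poissonMeasure_le_liminf hm hC hn hk hδ hs hG

end LimitTheorems

end CouponCollector

theorem theorem2 (m : ℕ) (hm : 1 ≤ m)
    {Ω : ℕ+ → Type*} [∀ n, MeasurableSpace (Ω n)]
    (P : ∀ n, Measure (Ω n)) [∀ n, IsProbabilityMeasure (P n)]
    (C : ∀ n : ℕ+, ℕ → Ω n → Fin n) (hC : ∀ n, IsCouponSequence (C n) (P n)) :
    -- first part: `k_j` is the centring plus `δ_j`, with `δ_j → d`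
    (∀ (d : ℝ) (n : ℕ → ℕ+) (δ : ℕ → ℝ) (k : ℕ → ℕ),
      StrictMono n → Tendsto δ atTop (𝓝 d) →
      (∀ j, 2 ≤ n j → (k j : ℝ) = centre m (n j) + δ j) →
      TendstoInDistribution
        (fun j (ω : Ω (n j)) =>
          (normalizedTotal m (fun t => C (n j) t ω), kTons m (k j) (fun t => C (n j) t ω)))
        atTop (id : ℝ × ℕ → ℝ × ℕ) (fun j => P (n j)) (limitLaw m d)) ∧
    -- second part: the offset is `g(n)`
    (∀ (g : ℕ+ → ℝ) (k : ℕ+ → ℕ),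
      g =o[atTop] (fun n : ℕ+ => Real.log (Real.log n)) → Tendsto g atTop atTop →
      (∀ n : ℕ+, 2 ≤ n → (k n : ℝ) = centre m n + g n) →
      ∀ ε : ℝ, 0 < ε →
        Tendsto (fun n : ℕ+ => P n {ω | ε ≤ |(kTons m (k n) (fun t => C n t ω) : ℝ) - 0|})
          atTop (𝓝 0)) ∧
    -- third part: the offset is `-g(n)`
    (∀ (g : ℕ+ → ℝ) (k : ℕ+ → ℕ),
      g =o[atTop] (fun n : ℕ+ => Real.log (Real.log n)) → Tendsto g atTop atTop →
      (∀ n : ℕ+, 2 ≤ n → (k n : ℝ) = centre m n - g n) →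
      Tendsto (fun n : ℕ+ => P n {ω | kTons m (k n) (fun t => C n t ω) = 0}) atTop (𝓝 0)) := by
  have hcoe : Tendsto (fun n : ℕ+ => (n : ℕ)) atTop atTop :=
    tendsto_atTop_atTop.2 fun b =>
      ⟨b.succPNat, fun a ha => (Nat.le_succ b).trans (by exact_mod_cast ha)⟩
  have htwo : ∀ᶠ n : ℕ+ in atTop, 2 ≤ n := eventually_ge_atTop 2
  refine ⟨fun d n δ k hn hδ hk => ?_, fun g k hg hgtop hk ε hε => ?_, fun g k hg hgtop hk => ?_⟩
  · exact tendstoInDistribution_normalizedTotal_kTons hm (fun j => hC (n j))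
      hn.tendsto_atTop
      ((hn.tendsto_atTop.eventually_ge_atTop 2).mono fun j hj => hk j (by exact_mod_cast hj)) hδ
  · have hne := tendsto_measure_kTons_ne_zero hm hC hcoe (htwo.mono hk) hg hgtop
    refine tendsto_of_tendsto_of_tendsto_of_le_of_le tendsto_const_nhds hne
      (fun n => zero_le) fun n => measure_mono fun ω (hω : ε ≤ _) h => hω.not_gt ?_
    simpa [h] using hε
  · exact tendsto_measure_kTons_eq_zero hm hC hcoe
      (htwo.mono fun n hn => (hk n hn).trans (sub_eq_add_neg _ _)) hg.neg_left
      (tendsto_neg_atTop_atBot.comp hgtop)
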